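/- Let $n \geq 0$ be an integer, let $|\cdot|$ be the Euclidean norm on $\mathbb{R}^n$ and let $B^n = \{x \in \mathbb{R}^n : |x| \leq 1\}$. A unit cube in $\mathbb{R}^n$ is the image of $(0,1)^n$ or of $[0,1]^n$ under a Euclidean isometry of $\mathbb{R}^n$. Let $Q \subset \mathbb{R}^n$ be a unit cube and let $\mu$ be a probability measure on $Q$ that has a density $f : Q \to [0,\infty)$ with respect to Lebesgue measure such that $f$ is convex on $Q$ and log-concave on $Q$, i.e. $-\log f : Q \to (-\infty, +\infty]$ is convex, where $-\log 0 = +\infty$. Then for every Borel set $A \subseteq \mathbb{R}^n$ and every $t > 0$, $$\mu(A) \geq \tfrac12 \quad \Longrightarrow \quad \mu(A + tB^n) \geq 1 - \exp(-t^2/9),$$ where $A + tB^n = \{x + ty : x \in A,\ y \in B^n\}$. -/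

import Mathlib

open scoped Pointwise

/-- The open coordinate cube `(0,1)^n` in Euclidean space. -/
def openCube (n : ℕ) : Set (EuclideanSpace ℝ (Fin n)) :=
  {x | ∀ i, 0 < x i ∧ x i < 1}

/-- The closed coordinate cube `[0,1]^n` in Euclidean space. -/
def closedCube (n : ℕ) : Set (EuclideanSpace ℝ (Fin n)) :=
  {x | ∀ i, 0 ≤ x i ∧ x i ≤ 1}

/-- A unit cube: a congruent copy (in any position and orientation) of `(0,1)^n` or of its
closure `[0,1]^n`. -/
def IsUnitCube {n : ℕ} (Q : Set (EuclideanSpace ℝ (Fin n))) : Prop :=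
  ∃ e : EuclideanSpace ℝ (Fin n) ≃ᵃⁱ[ℝ] EuclideanSpace ℝ (Fin n),
    Q = e '' openCube n ∨ Q = e '' closedCube n

/-- `f` is a log-concave function on `Q`: it is non-negative and `-log f` is convex on `Q` as a
function with values in `(-∞, +∞]`, where `-log 0 = +∞`. Equivalently, `-log f` is convex on the
set of points of `Q` where `f` is positive; that this set is convex is part of `ConvexOn`. -/
def LogConcaveOn {n : ℕ} (Q : Set (EuclideanSpace ℝ (Fin n)))
    (f : EuclideanSpace ℝ (Fin n) → ℝ) : Prop :=
  (∀ x ∈ Q, 0 ≤ f x) ∧ ConvexOn ℝ {x | x ∈ Q ∧ 0 < f x} (fun x => -Real.log (f x))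

/-- `μ` is carried by `Q` and has the density `f` there with respect to Lebesgue measure. -/
def HasDensityOn {n : ℕ} (μ : MeasureTheory.Measure (EuclideanSpace ℝ (Fin n)))
    (Q : Set (EuclideanSpace ℝ (Fin n))) (f : EuclideanSpace ℝ (Fin n) → ℝ) : Prop :=
  μ = (MeasureTheory.volume.restrict Q).withDensity (fun x => ENNReal.ofReal (f x))

/-!
The proof goes through an infinitesimal Prékopa–Leindler inequality with a quadratic cost, which is
the dual form of a transport–entropy inequality.

For functions `F`, `V`, `H` on the unit cube, bounded and bounded away from `0`, with
`F x ^ (1 - s) * V y ^ s * exp (-(2 / 9) * s * |x - y| ^ 2) ≤ H ((1 - s) * x + s * y)`,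
one has `(∫ F) ^ (1 - s) * (∫ V) ^ s ≤ ∫ H` as soon as `F` is convex along the coordinate directions
and `s` is small in terms of the bounds (`prekopaLeindler_cost_cube`).  The dimension is reduced by
passing to slices and marginals, under which coordinatewise convexity persists.  In dimension one
(`prekopaLeindler_cost_unitInterval`), `H` is integrated along `x ↦ (1 - s) * x + s * T x`, where `T`
is the increasing rearrangement of `F` into `V`.  To first order in `s` the Jacobian gains
`T' - 1 - log T'` and the cost loses `(2 / 9) * (T x - x) ^ 2`.  The gain wins by the inequality
`∫ F * (T x - x) ^ 2 ≤ 4 * ∫ F * (T' - 1 - log T')` (`integral_sq_displacement_le`), an integration by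
parts against a primitive of `F` which is at most `F / 2` in absolute value.  Such a primitive exists
because `F` is convex on an interval of length one (`exists_primitive_abs_le_half`).

Let `f` be the density, `B` the set of points at distance at least `t` from `A`, and `d` the distance
to `B`, truncated at `t`.  Log-concavity of `f` allows one to take `F = f`,
`V = f * exp (-(4 / 9) * t * d)` and `H = f * exp (-(2 / 9) * s * d ^ 2)`.  As `s → 0` this gives
`∫ f * exp (-(4 / 9) * t * d) ≤ exp (-(2 / 9) * ∫ f * d ^ 2)`.  The left side is at least `μ B`,
because `d = 0` on `B`; the right side is at most `exp (-t ^ 2 / 9)`, because `d = t` on `A` and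
`μ A ≥ 1 / 2`.

Densities that vanish somewhere are approximated by the positive ones of `expReg`, and densities
known only on the open cube are restricted to concentric closed subcubes.
-/

open MeasureTheory Set

/-! ### Scalar inequalities -/

lemma neg_sub_sq_le_log_one_sub {x : ℝ} (hx : |x| ≤ 1 / 2) : -x - x ^ 2 ≤ Real.log (1 - x) := by
  have h := Real.abs_log_sub_add_sum_range_le (x := x) (by linarith) 4
  have h5 : |x| ^ 5 / (1 - |x|) ≤ 2 * |x| ^ 5 := by
    rw [div_le_iff₀ (by linarith)]
    nlinarith [pow_nonneg (abs_nonneg x) 5]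
  have h1 := (abs_le.mp (h.trans h5)).1
  simp only [Finset.sum_range_succ, Finset.sum_range_zero] at h1
  norm_num at h1
  have e2 : |x| ^ 2 = x ^ 2 := sq_abs x
  have h3 : x ^ 3 ≤ |x| ^ 3 := by
    have := le_abs_self (x ^ 3)
    rwa [abs_pow] at this
  have h4 : x ^ 4 = |x| ^ 4 := by rw [show x ^ 4 = (x ^ 2) ^ 2 by ring, ← e2]; ring
  have h0 := abs_nonneg x
  have : |x| ^ 2 / 2 + |x| ^ 3 / 3 + |x| ^ 4 / 4 + 2 * |x| ^ 5 ≤ |x| ^ 2 := by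
    have a1 : |x| ^ 3 ≤ |x| ^ 2 * (1 / 2) := by nlinarith [sq_nonneg |x|]
    have a2 : |x| ^ 4 ≤ |x| ^ 3 * (1 / 2) := by nlinarith [pow_nonneg h0 3]
    have a3 : |x| ^ 5 ≤ |x| ^ 4 * (1 / 2) := by nlinarith [pow_nonneg h0 4]
    nlinarith [pow_nonneg h0 2]
  rw [h4] at h1
  nlinarith

/-- The Legendre-type lower bound for the relative-entropy integrand `r - 1 - log r`. -/
lemma mul_sub_one_sub_sq_le {r l : ℝ} (hr : 0 < r) (hl : |l| ≤ 1 / 2) :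
    l * (r - 1) - l ^ 2 ≤ r - 1 - Real.log r := by
  have h1 : 0 < 1 - l := by linarith [le_abs_self l]
  have h2 := Real.log_le_sub_one_of_pos (mul_pos hr h1)
  rw [Real.log_mul hr.ne' h1.ne'] at h2
  have := neg_sub_sq_le_log_one_sub hl
  linarith

lemma sub_one_sub_log_nonneg {r : ℝ} (hr : 0 < r) : 0 ≤ r - 1 - Real.log r := by
  linarith [Real.log_le_sub_one_of_pos hr]

/-- The constant with which `r - 1 - log r` dominates `(r - 1) * log r` on `[R⁻¹, R]`. -/
noncomputable def entropyConst (R : ℝ) : ℝ := R * (√R + 1) ^ 2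

lemma one_le_entropyConst {R : ℝ} (hR : 1 ≤ R) : 1 ≤ entropyConst R := by
  unfold entropyConst
  have := Real.sqrt_nonneg R
  nlinarith

lemma sub_one_mul_log_le {R r : ℝ} (hR : 1 ≤ R) (h1 : R⁻¹ ≤ r) (h2 : r ≤ R) :
    (r - 1) * Real.log r ≤ entropyConst R * (r - 1 - Real.log r) := by
  have hR0 : 0 < R := by linarith
  have hr : 0 < r := (inv_pos.mpr hR0).trans_le h1
  have hRr : 1 ≤ R * r := by
    calc (1 : ℝ) = R * R⁻¹ := by field_simp
      _ ≤ R * r := by gcongr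
  have A : (r - 1) * Real.log r ≤ R * (r - 1) ^ 2 := by
    rcases le_total 1 r with h | h
    · have := Real.log_le_sub_one_of_pos hr
      nlinarith [mul_nonneg (sub_nonneg.2 h) (sub_nonneg.2 this), sq_nonneg (r - 1)]
    · have h3 := Real.one_sub_inv_le_log_of_pos hr
      have h4 : (1 - r) * (1 - Real.log r - 1) ≤ (1 - r) * (r⁻¹ - 1) := by
        apply mul_le_mul_of_nonneg_left _ (by linarith)
        linarith
      have h5 : r⁻¹ ≤ R := inv_le_of_inv_le₀ hR0 h1
      have h6 : r⁻¹ - 1 = r⁻¹ * (1 - r) := by field_simp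
      rw [h6] at h4
      nlinarith [mul_le_mul_of_nonneg_right h5 (sq_nonneg (1 - r))]
  have B : (√r - 1) ^ 2 ≤ r - 1 - Real.log r := by
    have h3 := Real.log_le_sub_one_of_pos (Real.sqrt_pos.2 hr)
    rw [Real.log_sqrt hr.le] at h3
    nlinarith [Real.sq_sqrt hr.le]
  have C : (r - 1) ^ 2 ≤ (√R + 1) ^ 2 * (√r - 1) ^ 2 := by
    have h3 : r - 1 = (√r + 1) * (√r - 1) := by nlinarith [Real.sq_sqrt hr.le]
    have h4 : (√r + 1) ^ 2 ≤ (√R + 1) ^ 2 := by gcongr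
    calc (r - 1) ^ 2 = (√r + 1) ^ 2 * (√r - 1) ^ 2 := by rw [← mul_pow, ← h3]
      _ ≤ _ := by gcongr
  unfold entropyConst
  calc (r - 1) * Real.log r ≤ R * (r - 1) ^ 2 := A
    _ ≤ R * ((√R + 1) ^ 2 * (√r - 1) ^ 2) := by gcongr
    _ ≤ R * ((√R + 1) ^ 2 * (r - 1 - Real.log r)) := by gcongr
    _ = _ := by ring

/-- Pointwise estimate of the Prékopa–Leindler integrand to first order in `s`: the Jacobian
factor gains almost `s * (r - 1 - log r)`, the cost factor loses at most `s * (2 / 9) * h ^ 2`. -/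
lemma one_add_le_jacobian_mul_cost {R r s h : ℝ} (hR : 1 ≤ R) (h1 : R⁻¹ ≤ r) (h2 : r ≤ R)
    (hs : 0 < s) (hsR : s * entropyConst R ≤ 1 / 18) (hh : h ^ 2 ≤ 1) :
    1 + s * (8 / 9 * (r - 1 - Real.log r) - 2 / 9 * h ^ 2) ≤
      (1 - s + s * r) * r ^ (-s) * Real.exp (-(2 / 9 * s * h ^ 2)) := by
  have hK := one_le_entropyConst hR
  have hr : 0 < r := (inv_pos.mpr (by linarith)).trans_le h1
  have hs1 : s ≤ 1 / 18 := by nlinarith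
  set K := entropyConst R
  set X := r - 1 - Real.log r with hX
  have hX0 : 0 ≤ X := sub_one_sub_log_nonneg hr
  have hlog := sub_one_mul_log_le hR h1 h2
  have e1 : 1 + s * (1 - s * K) * X ≤ (1 - s + s * r) * r ^ (-s) := by
    have h3 : 1 - s * Real.log r ≤ r ^ (-s) := by
      rw [Real.rpow_def_of_pos hr]
      linarith [Real.add_one_le_exp (Real.log r * -s)]
    calc 1 + s * (1 - s * K) * X = 1 + s * X - s ^ 2 * (K * X) := by ring
      _ ≤ 1 + s * X - s ^ 2 * ((r - 1) * Real.log r) := by gcongr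
      _ = (1 - s + s * r) * (1 - s * Real.log r) := by rw [hX]; ring
      _ ≤ _ := by
        apply mul_le_mul_of_nonneg_left h3
        nlinarith [mul_pos hs hr]
  have e2 : 1 - 2 / 9 * s * h ^ 2 ≤ Real.exp (-(2 / 9 * s * h ^ 2)) := by
    linarith [Real.add_one_le_exp (-(2 / 9 * s * h ^ 2))]
  have hsh : s * h ^ 2 ≤ s := by nlinarith
  have e0 : 0 ≤ 1 - 2 / 9 * s * h ^ 2 := by nlinarith
  have e3 : 0 ≤ s * (1 - s * K) * X := by
    apply mul_nonneg (mul_nonneg hs.le _) hX0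
    linarith
  refine le_trans ?_ (mul_le_mul e1 e2 e0 (by linarith))
  have e4 : (8 / 9 : ℝ) ≤ (1 - s * K) * (1 - 2 / 9 * s * h ^ 2) := by
    have : (17 / 18 : ℝ) * (80 / 81) ≤ (1 - s * K) * (1 - 2 / 9 * s * h ^ 2) :=
      mul_le_mul (by linarith) (by nlinarith) (by norm_num) (by linarith)
    linarith
  nlinarith [mul_le_mul_of_nonneg_left e4 (mul_nonneg hs.le hX0)]

/-! ### Transport on the unit interval -/

/-- The trapezoid (Hermite–Hadamard) inequality for convex functions. -/
lemma integral_le_trapezoid {F : ℝ → ℝ} (hF : Continuous F) (hc : ConvexOn ℝ (Icc 0 1) F)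
    {a b : ℝ} (ha : 0 ≤ a) (hab : a ≤ b) (hb : b ≤ 1) :
    ∫ u in a..b, F u ≤ (b - a) * ((F a + F b) / 2) := by
  have hrefl : ∫ u in a..b, F (a + b - u) = ∫ u in a..b, F u := by
    rw [intervalIntegral.integral_comp_sub_left]
    simp
  have hi : ∀ G : ℝ → ℝ, Continuous G → IntervalIntegrable G volume a b :=
    fun G hG => hG.intervalIntegrable a b
  have key : ∫ u in a..b, (F u + F (a + b - u)) ≤ ∫ _u in a..b, (F a + F b) := by
    apply intervalIntegral.integral_mono_on hab (hi _ (by fun_prop)) (hi _ (by fun_prop))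
    intro u hu
    rcases hab.eq_or_lt with rfl | hlt
    · obtain rfl : u = a := le_antisymm hu.2 hu.1
      simp
    have hba : 0 < b - a := by linarith
    have hA : a ∈ Icc (0 : ℝ) 1 := ⟨ha, by linarith⟩
    have hB : b ∈ Icc (0 : ℝ) 1 := ⟨by linarith, hb⟩
    have hw1 : 0 ≤ (b - u) / (b - a) := div_nonneg (by linarith [hu.2]) hba.le
    have hw2 : 0 ≤ (u - a) / (b - a) := div_nonneg (by linarith [hu.1]) hba.le
    have hw : (b - u) / (b - a) + (u - a) / (b - a) = 1 := by field_simp; ring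
    have c1 := hc.2 hA hB hw1 hw2 hw
    have c2 := hc.2 hB hA hw1 hw2 hw
    simp only [smul_eq_mul] at c1 c2
    have e1 : (b - u) / (b - a) * a + (u - a) / (b - a) * b = u := by field_simp; ring
    have e2 : (b - u) / (b - a) * b + (u - a) / (b - a) * a = a + b - u := by field_simp; ring
    rw [e1] at c1
    rw [e2] at c2
    have e3 : (b - u) / (b - a) = 1 - (u - a) / (b - a) := by linarith
    rw [e3] at c1 c2
    nlinarith
  rw [intervalIntegral.integral_add (hi _ hF) (hi _ (by fun_prop)), hrefl,
    intervalIntegral.integral_const, smul_eq_mul] at key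
  linarith

/-- A convex weight on `[0,1]` has a primitive that it dominates twofold.  This is the only place
where the convexity of the density enters. -/
lemma exists_primitive_abs_le_half {F : ℝ → ℝ} (hF : Continuous F)
    (hc : ConvexOn ℝ (Icc 0 1) F) (h0 : ∀ x ∈ Icc (0 : ℝ) 1, 0 ≤ F x) :
    ∃ k : ℝ, ∀ x ∈ Icc (0 : ℝ) 1, |k - ∫ u in (0 : ℝ)..x, F u| ≤ F x / 2 := by
  set I : ℝ → ℝ := fun x => ∫ u in (0 : ℝ)..x, F u with hI
  have hii : ∀ a b, IntervalIntegrable F volume a b := fun a b => hF.intervalIntegrable a b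
  have key : ∀ x ∈ Icc (0 : ℝ) 1, ∀ y ∈ Icc (0 : ℝ) 1, I x - F x / 2 ≤ I y + F y / 2 := by
    intro x hx y hy
    have hsub : I x - I y = ∫ u in y..x, F u :=
      intervalIntegral.integral_interval_sub_left (hii _ _) (hii _ _)
    have hFx := h0 x hx
    have hFy := h0 y hy
    rcases le_total y x with h | h
    · have := integral_le_trapezoid hF hc hy.1 h hx.2
      nlinarith [hx.2, hy.1]
    · have h2 : 0 ≤ ∫ u in x..y, F u :=
        intervalIntegral.integral_nonneg h fun u hu => h0 u ⟨hx.1.trans hu.1, hu.2.trans hy.2⟩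
      rw [intervalIntegral.integral_symm] at hsub
      linarith
  have h01 : (0 : ℝ) ∈ Icc (0 : ℝ) 1 := by simp
  refine ⟨sSup ((fun x => I x - F x / 2) '' Icc 0 1), fun x hx => ?_⟩
  have hb : BddAbove ((fun x => I x - F x / 2) '' Icc (0 : ℝ) 1) := by
    refine ⟨I 0 + F 0 / 2, ?_⟩
    rintro _ ⟨y, hy, rfl⟩
    exact key y hy 0 h01
  have h1 := le_csSup hb (mem_image_of_mem _ hx)
  have h2 : sSup ((fun x => I x - F x / 2) '' Icc (0 : ℝ) 1) ≤ I x + F x / 2 := by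
    apply csSup_le ⟨_, mem_image_of_mem _ h01⟩
    rintro _ ⟨y, hy, rfl⟩
    exact key y hy x hx
  rw [abs_le]
  constructor <;> linarith

/-- A Poincaré-type inequality for the displacement `T x - x` of an increasing map of `[0,1]` onto
itself, with respect to a convex weight and with the entropy integrand in place of the square of
the derivative.  With `P` a primitive of `-F` bounded by `F / 2`, the function
`(T x - x) ^ 2 * P x / 2` vanishes at both ends, so its derivative integrates to `0`. -/
lemma integral_sq_displacement_le {F T r : ℝ → ℝ} (hF : Continuous F)
    (hc : ConvexOn ℝ (Icc 0 1) F) (h0 : ∀ x ∈ Icc (0 : ℝ) 1, 0 < F x)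
    (hT : ∀ x, HasDerivAt T (r x) x) (hr : Continuous r) (hr0 : ∀ x, 0 < r x)
    (hT0 : T 0 = 0) (hT1 : T 1 = 1) (hd : ∀ x ∈ Icc (0 : ℝ) 1, |T x - x| ≤ 1) :
    1 / 4 * ∫ x in (0 : ℝ)..1, F x * (T x - x) ^ 2 ≤
      ∫ x in (0 : ℝ)..1, F x * (r x - 1 - Real.log (r x)) := by
  obtain ⟨k, hk⟩ := exists_primitive_abs_le_half hF hc fun x hx => (h0 x hx).le
  set P : ℝ → ℝ := fun x => k - ∫ u in (0 : ℝ)..x, F u with hP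
  have hPd : ∀ x, HasDerivAt P (-F x) x := fun x =>
    (intervalIntegral.integral_hasDerivAt_right (hF.intervalIntegrable _ _)
      hF.aestronglyMeasurable.stronglyMeasurableAtFilter hF.continuousAt).const_sub k
  have hTc : Continuous T := continuous_iff_continuousAt.2 fun x => (hT x).continuousAt
  have hPc : Continuous P := continuous_iff_continuousAt.2 fun x => (hPd x).continuousAt
  have hlogc : Continuous fun x => Real.log (r x) := hr.log fun x => (hr0 x).ne'
  set D : ℝ → ℝ := fun x => (T x - x) * (r x - 1) * P x - F x * (T x - x) ^ 2 / 2 with hDdef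
  have hDc : Continuous D := by fun_prop
  have hD : ∀ x, HasDerivAt (fun x => (T x - x) ^ 2 * P x / 2) (D x) x := by
    intro x
    have := ((((hT x).sub (hasDerivAt_id x)).pow 2).mul (hPd x)).div_const 2
    refine this.congr_deriv ?_
    simp [hDdef]
    ring
  have hzero : ∫ x in (0 : ℝ)..1, D x = 0 := by
    rw [intervalIntegral.integral_eq_sub_of_hasDerivAt (fun x _ => hD x)
      (hDc.intervalIntegrable _ _)]
    simp [hT0, hT1]
  have hcont : Continuous fun x => F x * (T x - x) ^ 2 := by fun_prop
  have hle : ∫ x in (0 : ℝ)..1, (D x + 1 / 4 * (F x * (T x - x) ^ 2)) ≤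
      ∫ x in (0 : ℝ)..1, F x * (r x - 1 - Real.log (r x)) := by
    apply intervalIntegral.integral_mono_on zero_le_one
    · exact Continuous.intervalIntegrable (by fun_prop) _ _
    · exact Continuous.intervalIntegrable (by fun_prop) _ _
    intro x hx
    have hFx := h0 x hx
    have hPx : |P x / F x| ≤ 1 / 2 := by
      rw [abs_div, abs_of_pos hFx, div_le_iff₀ hFx]
      linarith [hk x hx]
    have hdx := hd x hx
    -- the slope `l` is chosen so that `F * l * (r - 1)` is the first term of `D`
    have hl : |(T x - x) * (P x / F x)| ≤ 1 / 2 := by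
      rw [abs_mul]
      calc |T x - x| * |P x / F x| ≤ 1 * (1 / 2) := by gcongr
        _ = _ := by norm_num
    have h1 := mul_le_mul_of_nonneg_left (mul_sub_one_sub_sq_le (hr0 x) hl) hFx.le
    refine le_trans ?_ h1
    have hsq : (P x / F x) ^ 2 ≤ 1 / 4 := by
      rw [← sq_abs]
      nlinarith [abs_nonneg (P x / F x)]
    have e : F x * ((T x - x) * (P x / F x) * (r x - 1)) = (T x - x) * (r x - 1) * P x := by
      field_simp
    rw [mul_sub, e, mul_pow]
    have := mul_le_mul_of_nonneg_left hsq (mul_nonneg hFx.le (sq_nonneg (T x - x)))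
    simp only [hDdef]
    linarith
  rw [intervalIntegral.integral_add (hDc.intervalIntegrable _ _)
    (Continuous.intervalIntegrable (by fun_prop) _ _), hzero,
    intervalIntegral.integral_const_mul] at hle
  linarith

/-- The increasing rearrangement between two positive continuous densities on `[0,1]`, extended to
the whole line; `r` is its derivative. -/
lemma exists_monotone_transport {F V : ℝ → ℝ} (hF : Continuous F) (hV : Continuous V)
    (hF0 : ∀ x, 0 < F x) {m : ℝ} (hm : 0 < m) (hV0 : ∀ x, m ≤ V x) :
    ∃ T r : ℝ → ℝ, (∀ x, HasDerivAt T (r x) x) ∧ Continuous r ∧ (∀ x, 0 < r x) ∧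
      T 0 = 0 ∧ T 1 = 1 ∧ ∀ x, V (T x) * r x =
        (∫ u in (0 : ℝ)..1, V u) / (∫ u in (0 : ℝ)..1, F u) * F x := by
  have hV1 : ∀ x, 0 < V x := fun x => hm.trans_le (hV0 x)
  set G : ℝ → ℝ := fun y => ∫ u in (0 : ℝ)..y, V u with hG
  set Φ : ℝ → ℝ := fun y => ∫ u in (0 : ℝ)..y, F u with hΦ
  have hGd : ∀ x, HasDerivAt G (V x) x := fun x =>
    intervalIntegral.integral_hasDerivAt_right (hV.intervalIntegrable _ _)
      hV.aestronglyMeasurable.stronglyMeasurableAtFilter hV.continuousAt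
  have hΦd : ∀ x, HasDerivAt Φ (F x) x := fun x =>
    intervalIntegral.integral_hasDerivAt_right (hF.intervalIntegrable _ _)
      hF.aestronglyMeasurable.stronglyMeasurableAtFilter hF.continuousAt
  have hGc : Continuous G := continuous_iff_continuousAt.2 fun x => (hGd x).continuousAt
  have hGm : StrictMono G := strictMono_of_hasDerivAt_pos hGd hV1
  have hsub : ∀ a b, G b - G a = ∫ u in a..b, V u := fun a b =>
    intervalIntegral.integral_interval_sub_left (hV.intervalIntegrable _ _)
      (hV.intervalIntegrable _ _)
  have hgrow : ∀ a b, a ≤ b → m * (b - a) ≤ G b - G a := by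
    intro a b hab
    rw [hsub]
    calc m * (b - a) = ∫ _u in a..b, m := by simp [mul_comm]
      _ ≤ _ := intervalIntegral.integral_mono_on hab (by simp) (hV.intervalIntegrable _ _)
        fun u _ => hV0 u
  have hG0 : G 0 = 0 := by simp [hG]
  have hΦ0 : Φ 0 = 0 := by simp [hΦ]
  have htop : Filter.Tendsto G Filter.atTop Filter.atTop := by
    refine Filter.tendsto_atTop_mono' _ ?_ (Filter.tendsto_id.const_mul_atTop hm)
    filter_upwards [Filter.eventually_ge_atTop 0] with x hx
    have := hgrow 0 x hx
    simp only [id]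
    linarith
  have hbot : Filter.Tendsto G Filter.atBot Filter.atBot := by
    refine Filter.tendsto_atBot_mono' _ ?_ (Filter.tendsto_id.const_mul_atBot hm)
    filter_upwards [Filter.eventually_le_atBot 0] with x hx
    have := hgrow x 0 hx
    simp only [id]
    linarith
  have hsurj : Function.Surjective G := hGc.surjective htop hbot
  set e := hGm.orderIsoOfSurjective G hsurj with he
  have heG : ∀ x, e x = G x := fun x => rfl
  set κ := G 1 / Φ 1 with hκ
  have hG1 : 0 < G 1 := by simpa [hG0] using hGm zero_lt_one
  have hΦ1 : 0 < Φ 1 := by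
    simpa [hΦ0] using strictMono_of_hasDerivAt_pos hΦd hF0 zero_lt_one
  have hκ0 : 0 < κ := div_pos hG1 hΦ1
  have hinvc : Continuous e.symm := e.toHomeomorph.symm.continuous
  have hinvd : ∀ y, HasDerivAt e.symm (V (e.symm y))⁻¹ y := fun y =>
    HasDerivAt.of_local_left_inverse hinvc.continuousAt (hGd _) (hV1 _).ne'
      (Filter.Eventually.of_forall fun z => by rw [← heG]; simp)
  refine ⟨fun x => e.symm (κ * Φ x), fun x => (V (e.symm (κ * Φ x)))⁻¹ * (κ * F x), ?_, ?_, ?_,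
    ?_, ?_, ?_⟩
  · intro x
    exact (hinvd (κ * Φ x)).comp x ((hΦd x).const_mul κ)
  · have hΦc : Continuous Φ := continuous_iff_continuousAt.2 fun x => (hΦd x).continuousAt
    have : Continuous fun x => V (e.symm (κ * Φ x)) :=
      hV.comp (hinvc.comp (hΦc.const_mul κ))
    exact (this.inv₀ fun x => (hV1 _).ne').mul (hF.const_mul κ)
  · intro x
    exact mul_pos (inv_pos.2 (hV1 _)) (mul_pos hκ0 (hF0 x))
  · rw [OrderIso.symm_apply_eq, heG]
    simp [hG0, hΦ0]
  · simp only
    rw [OrderIso.symm_apply_eq, heG, hκ]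
    field_simp
  · intro x
    have := (hV1 (e.symm (κ * Φ x))).ne'
    field_simp

/-! ### Prékopa–Leindler with a quadratic cost on the unit interval -/

lemma integral_mem_Icc_of_bounds {F : ℝ → ℝ} (hF : Continuous F) {m L : ℝ}
    (hm : ∀ x, m ≤ F x) (hL : ∀ x, F x ≤ L) :
    m ≤ ∫ u in (0 : ℝ)..1, F u ∧ ∫ u in (0 : ℝ)..1, F u ≤ L := by
  have hi := hF.intervalIntegrable (μ := volume) 0 1
  constructor
  · calc m = ∫ _u in (0 : ℝ)..1, m := by simp
      _ ≤ _ := intervalIntegral.integral_mono_on zero_le_one (by simp) hi fun u _ => hm u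
  · calc ∫ u in (0 : ℝ)..1, F u ≤ ∫ _u in (0 : ℝ)..1, L :=
        intervalIntegral.integral_mono_on zero_le_one hi (by simp) fun u _ => hL u
      _ = L := by simp

/-- The Prékopa–Leindler inequality on `[0,1]` with a quadratic cost in its hypothesis.  It holds
because the first function `F` is convex and the parameter `s` is small in terms of the bounds on
the two functions. -/
theorem prekopaLeindler_cost_unitInterval {F V H : ℝ → ℝ} (hF : Continuous F) (hV : Continuous V)
    (hH : Continuous H) (hc : ConvexOn ℝ (Icc 0 1) F) {m L s : ℝ} (hm : 0 < m)
    (hFm : ∀ x, m ≤ F x) (hFL : ∀ x, F x ≤ L) (hVm : ∀ x, m ≤ V x) (hVL : ∀ x, V x ≤ L)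
    (hs : 0 < s) (hsR : s * entropyConst ((L / m) ^ 2) ≤ 1 / 18)
    (h : ∀ x ∈ Icc (0 : ℝ) 1, ∀ y ∈ Icc (0 : ℝ) 1,
      F x ^ (1 - s) * V y ^ s * Real.exp (-(2 / 9 * s * (x - y) ^ 2)) ≤ H ((1 - s) * x + s * y)) :
    (∫ x in (0 : ℝ)..1, F x) ^ (1 - s) * (∫ x in (0 : ℝ)..1, V x) ^ s ≤
      ∫ x in (0 : ℝ)..1, H x := by
  obtain ⟨T, r, hT, hr, hr0, hT0, hT1, hTV⟩ :=
    exists_monotone_transport hF hV (fun x => hm.trans_le (hFm x)) hm hVm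
  set ZF := ∫ x in (0 : ℝ)..1, F x with hZF
  set ZV := ∫ x in (0 : ℝ)..1, V x with hZV
  obtain ⟨zf1, zf2⟩ := integral_mem_Icc_of_bounds hF hFm hFL
  obtain ⟨zv1, zv2⟩ := integral_mem_Icc_of_bounds hV hVm hVL
  have hZF0 : 0 < ZF := hm.trans_le zf1
  have hZV0 : 0 < ZV := hm.trans_le zv1
  have hmL : m ≤ L := (hFm 0).trans (hFL 0)
  have hL : 0 < L := hm.trans_le hmL
  have hLm : 1 ≤ L / m := (one_le_div hm).2 hmL
  have hR : 1 ≤ (L / m) ^ 2 := one_le_pow₀ hLm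
  have hTm : StrictMono T := strictMono_of_hasDerivAt_pos hT hr0
  have hTI : ∀ x ∈ Icc (0 : ℝ) 1, T x ∈ Icc (0 : ℝ) 1 := fun x hx =>
    ⟨hT0 ▸ hTm.monotone hx.1, hT1 ▸ hTm.monotone hx.2⟩
  have hd : ∀ x ∈ Icc (0 : ℝ) 1, |T x - x| ≤ 1 := fun x hx => by
    have := hTI x hx
    rw [abs_le]
    constructor <;> linarith [this.1, this.2, hx.1, hx.2]
  have hTc : Continuous T := continuous_iff_continuousAt.2 fun x => (hT x).continuousAt
  set κ := ZV / ZF with hκ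
  have hκ0 : 0 < κ := div_pos hZV0 hZF0
  have hFx : ∀ x, 0 < F x := fun x => hm.trans_le (hFm x)
  have hVx : ∀ x, 0 < V x := fun x => hm.trans_le (hVm x)
  have hreq : ∀ x, r x = κ * F x / V (T x) := fun x => by
    rw [eq_div_iff (hVx _).ne', mul_comm, hTV]
  have hr1 : ∀ x, ((L / m) ^ 2)⁻¹ ≤ r x := fun x => by
    rw [hreq, hκ]
    calc ((L / m) ^ 2)⁻¹ = m / L * m / L := by field_simp
      _ ≤ ZV / ZF * F x / V (T x) := by
        gcongr
        · exact (mul_pos hκ0 (hFx x)).le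
        · exact hVx _
        · exact hFm x
        · exact hVL _
  have hr2 : ∀ x, r x ≤ (L / m) ^ 2 := fun x => by
    rw [hreq, hκ]
    calc ZV / ZF * F x / V (T x) ≤ L / m * L / m := by
          gcongr
          · exact (hFx x).le
          · exact hFL x
          · exact hVm _
      _ = _ := by ring
  have hlogc : Continuous fun x => Real.log (r x) := hr.log fun x => (hr0 x).ne'
  -- change of variables along the interpolating map
  have hsubst : ∫ x in (0 : ℝ)..1, H ((1 - s) * x + s * T x) * (1 - s + s * r x) =
      ∫ x in (0 : ℝ)..1, H x := by
    have := intervalIntegral.integral_comp_mul_deriv (a := 0) (b := 1) (g := H)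
      (f := fun x => (1 - s) * x + s * T x) (f' := fun x => 1 - s + s * r x)
      (fun x _ => (((hasDerivAt_id' x).const_mul (1 - s)).add ((hT x).const_mul s)).congr_deriv
        (by simp))
      (by fun_prop) hH
    simpa [hT0, hT1] using this
  rw [← hsubst]
  set E : ℝ → ℝ := fun x =>
    F x + s * (8 / 9 * (F x * (r x - 1 - Real.log (r x))) - 2 / 9 * (F x * (T x - x) ^ 2)) with hE
  have hpt : ∀ x ∈ Icc (0 : ℝ) 1,
      κ ^ s * E x ≤ H ((1 - s) * x + s * T x) * (1 - s + s * r x) := by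
    intro x hx
    have hj : 0 < 1 - s + s * r x := by
      have : s ≤ 1 / 18 := by nlinarith [one_le_entropyConst hR]
      nlinarith [mul_pos hs (hr0 x)]
    have hh2 : (T x - x) ^ 2 ≤ 1 := by
      rw [← sq_abs]
      nlinarith [hd x hx, abs_nonneg (T x - x)]
    have h1 := one_add_le_jacobian_mul_cost hR (hr1 x) (hr2 x) hs hsR hh2
    have h2 := mul_le_mul_of_nonneg_right (h x hx (T x) (hTI x hx)) hj.le
    have hVT : V (T x) = κ * F x * (r x)⁻¹ := by
      rw [← hTV, mul_assoc, mul_inv_cancel₀ (hr0 x).ne', mul_one]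
    have hpow : F x ^ (1 - s) * V (T x) ^ s = κ ^ s * F x * r x ^ (-s) := by
      rw [hVT, Real.mul_rpow (by have := hFx x; positivity) (inv_nonneg.2 (hr0 x).le),
        Real.mul_rpow hκ0.le (hFx x).le, Real.inv_rpow (hr0 x).le, ← Real.rpow_neg (hr0 x).le]
      have : F x ^ (1 - s) * F x ^ s = F x := by
        rw [← Real.rpow_add (hFx x)]
        simp
      linear_combination κ ^ s * r x ^ (-s) * this
    rw [hpow, show (x - T x) ^ 2 = (T x - x) ^ 2 by ring] at h2
    refine le_trans ?_ h2
    have hκs : 0 ≤ κ ^ s * F x := mul_nonneg (Real.rpow_nonneg hκ0.le _) (hFx x).le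
    have h3 := mul_le_mul_of_nonneg_left h1 hκs
    calc κ ^ s * E x = κ ^ s * F x *
          (1 + s * (8 / 9 * (r x - 1 - Real.log (r x)) - 2 / 9 * (T x - x) ^ 2)) := by
          simp only [hE]; ring
      _ ≤ _ := h3
      _ = _ := by ring
  have hEc : Continuous E := by fun_prop
  have hint : ∫ x in (0 : ℝ)..1, κ ^ s * E x ≤
      ∫ x in (0 : ℝ)..1, H ((1 - s) * x + s * T x) * (1 - s + s * r x) :=
    intervalIntegral.integral_mono_on zero_le_one
      (Continuous.intervalIntegrable (by fun_prop) _ _)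
      (Continuous.intervalIntegrable (by fun_prop) _ _) hpt
  refine le_trans ?_ hint
  have hpoin := integral_sq_displacement_le hF hc (fun x _ => hFx x) hT hr hr0 hT0 hT1 hd
  have hEint : ∫ x in (0 : ℝ)..1, E x = ZF + s * (8 / 9 * (∫ x in (0 : ℝ)..1,
      F x * (r x - 1 - Real.log (r x))) - 2 / 9 * ∫ x in (0 : ℝ)..1, F x * (T x - x) ^ 2) := by
    have i1 : IntervalIntegrable (fun x => F x * (r x - 1 - Real.log (r x))) volume 0 1 :=
      Continuous.intervalIntegrable (by fun_prop) _ _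
    have i2 : IntervalIntegrable (fun x => F x * (T x - x) ^ 2) volume 0 1 :=
      Continuous.intervalIntegrable (by fun_prop) _ _
    simp only [hE]
    rw [intervalIntegral.integral_add (hF.intervalIntegrable _ _)
        (((i1.const_mul _).sub (i2.const_mul _)).const_mul _),
      intervalIntegral.integral_const_mul,
      intervalIntegral.integral_sub (i1.const_mul _) (i2.const_mul _),
      intervalIntegral.integral_const_mul, intervalIntegral.integral_const_mul]
  rw [intervalIntegral.integral_const_mul, hEint]
  have hκs : 0 ≤ κ ^ s := Real.rpow_nonneg hκ0.le _
  calc ZF ^ (1 - s) * ZV ^ s = κ ^ s * ZF := by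
        rw [hκ, Real.div_rpow hZV0.le hZF0.le, Real.rpow_sub hZF0, Real.rpow_one]
        ring
    _ ≤ _ := by
      apply mul_le_mul_of_nonneg_left _ hκs
      nlinarith

/-! ### Prékopa–Leindler with a quadratic cost on the unit cube -/

lemma cons_mem_Icc_zero_one {n : ℕ} {x : ℝ} {y : Fin n → ℝ} :
    (Fin.cons x y : Fin (n + 1) → ℝ) ∈ Icc (0 : Fin (n + 1) → ℝ) 1 ↔
      x ∈ Icc (0 : ℝ) 1 ∧ y ∈ Icc (0 : Fin n → ℝ) 1 := by
  simp only [mem_Icc, Pi.le_def, Fin.forall_fin_succ, Fin.cons_zero, Fin.cons_succ, Pi.zero_apply,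
    Pi.one_apply]
  tauto

lemma integral_Icc_succ {n : ℕ} {f : (Fin (n + 1) → ℝ) → ℝ} (hf : Continuous f) :
    ∫ z in Icc (0 : Fin (n + 1) → ℝ) 1, f z =
      ∫ x in (0 : ℝ)..1, ∫ y in Icc (0 : Fin n → ℝ) 1, f (Fin.cons x y) := by
  have mp := (volume_preserving_piFinSuccAbove (fun _ : Fin (n + 1) => ℝ) 0).symm
  have happ : ∀ p : ℝ × (Fin n → ℝ),
      (MeasurableEquiv.piFinSuccAbove (fun _ : Fin (n + 1) => ℝ) 0).symm p = Fin.cons p.1 p.2 := by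
    intro p
    simp [MeasurableEquiv.piFinSuccAbove_symm_apply, Fin.insertNthEquiv]
  have hpre : (MeasurableEquiv.piFinSuccAbove (fun _ : Fin (n + 1) => ℝ) 0).symm ⁻¹'
      Icc (0 : Fin (n + 1) → ℝ) 1 = Icc (0 : ℝ) 1 ×ˢ Icc (0 : Fin n → ℝ) 1 := by
    ext p
    rw [mem_preimage, happ, cons_mem_Icc_zero_one, mem_prod]
  have h1 := mp.setIntegral_preimage_emb (MeasurableEquiv.measurableEmbedding _) f
    (Icc (0 : Fin (n + 1) → ℝ) 1)
  rw [← h1, hpre, intervalIntegral.integral_of_le zero_le_one, ← integral_Icc_eq_integral_Ioc]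
  simp_rw [happ]
  rw [Measure.volume_eq_prod]
  refine setIntegral_prod (fun p : ℝ × (Fin n → ℝ) => f (Fin.cons p.1 p.2)) ?_
  apply ContinuousOn.integrableOn_compact (isCompact_Icc.prod isCompact_Icc)
  fun_prop

lemma continuous_integral_cons {n : ℕ} {f : (Fin (n + 1) → ℝ) → ℝ} (hf : Continuous f) :
    Continuous fun x : ℝ => ∫ y in Icc (0 : Fin n → ℝ) 1, f (Fin.cons x y) := by
  apply continuous_parametric_integral_of_continuous _ isCompact_Icc
  simp only [Function.uncurry_def]
  fun_prop

lemma volume_real_Icc_zero_one (n : ℕ) : volume.real (Icc (0 : Fin n → ℝ) 1) = 1 := by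
  simp [measureReal_def, Real.volume_Icc_pi]

lemma setIntegral_Icc_mem_of_bounds {n : ℕ} {F : (Fin n → ℝ) → ℝ} (hF : Continuous F) {m L : ℝ}
    (hm : ∀ x, m ≤ F x) (hL : ∀ x, F x ≤ L) :
    m ≤ ∫ u in Icc (0 : Fin n → ℝ) 1, F u ∧ ∫ u in Icc (0 : Fin n → ℝ) 1, F u ≤ L := by
  have hi : IntegrableOn F (Icc (0 : Fin n → ℝ) 1) :=
    hF.continuousOn.integrableOn_compact isCompact_Icc
  have hconst : ∀ c : ℝ, IntegrableOn (fun _ => c) (Icc (0 : Fin n → ℝ) 1) := fun c =>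
    continuousOn_const.integrableOn_compact isCompact_Icc
  have hcv : ∀ c : ℝ, ∫ _u in Icc (0 : Fin n → ℝ) 1, c = c := fun c => by
    rw [setIntegral_const, volume_real_Icc_zero_one, one_smul]
  constructor
  · calc m = ∫ _u in Icc (0 : Fin n → ℝ) 1, m := (hcv m).symm
      _ ≤ _ := setIntegral_mono (hconst m) hi fun u => hm u
  · calc ∫ u in Icc (0 : Fin n → ℝ) 1, F u ≤ ∫ _u in Icc (0 : Fin n → ℝ) 1, L :=
        setIntegral_mono hi (hconst L) fun u => hL u
      _ = L := hcv L

/-- Convexity of `F` on the unit cube along each coordinate direction.  It passes to slices and to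
marginals. -/
def CoordConvex {n : ℕ} (F : (Fin n → ℝ) → ℝ) : Prop :=
  ∀ x ∈ Icc (0 : Fin n → ℝ) 1, ∀ i,
    ConvexOn ℝ (Icc (0 : ℝ) 1) fun τ => F (Function.update x i τ)

lemma CoordConvex.cons {n : ℕ} {F : (Fin (n + 1) → ℝ) → ℝ} (hF : CoordConvex F) {x : ℝ}
    (hx : x ∈ Icc (0 : ℝ) 1) : CoordConvex fun y : Fin n → ℝ => F (Fin.cons x y) := by
  intro y hy i
  have := hF (Fin.cons x y) (cons_mem_Icc_zero_one.2 ⟨hx, hy⟩) i.succ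
  simpa only [Fin.cons_update] using this

lemma CoordConvex.marginal {n : ℕ} {F : (Fin (n + 1) → ℝ) → ℝ} (hF : CoordConvex F)
    (hFc : Continuous F) :
    ConvexOn ℝ (Icc (0 : ℝ) 1) fun x => ∫ y in Icc (0 : Fin n → ℝ) 1, F (Fin.cons x y) := by
  refine ⟨convex_Icc 0 1, fun a ha b hb α β hα hβ hαβ => ?_⟩
  have hi : ∀ x : ℝ, IntegrableOn (fun y : Fin n → ℝ => F (Fin.cons x y)) (Icc 0 1) := fun x =>
    ContinuousOn.integrableOn_compact isCompact_Icc (by fun_prop)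
  simp only [smul_eq_mul]
  rw [← integral_const_mul, ← integral_const_mul,
    ← integral_add ((hi a).const_mul α) ((hi b).const_mul β)]
  apply setIntegral_mono_on (hi _) (((hi a).const_mul α).add ((hi b).const_mul β))
    measurableSet_Icc
  intro y hy
  have := (hF (Fin.cons 0 y) (cons_mem_Icc_zero_one.2 ⟨by simp, hy⟩) 0).2 ha hb hα hβ hαβ
  simpa only [Fin.update_cons_zero, smul_eq_mul, Pi.add_apply] using this

/-- The Prékopa–Leindler inequality on the unit cube with a quadratic cost in its hypothesis, by
induction on the dimension: the inequality for the slices is the hypothesis of the one-dimensional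
inequality for the marginals. -/
theorem prekopaLeindler_cost_cube {m L s : ℝ} (hm : 0 < m) (hs : 0 < s)
    (hsR : s * entropyConst ((L / m) ^ 2) ≤ 1 / 18) (n : ℕ) {F V H : (Fin n → ℝ) → ℝ}
    (hF : Continuous F) (hV : Continuous V) (hH : Continuous H) (hc : CoordConvex F)
    (hFm : ∀ x, m ≤ F x) (hFL : ∀ x, F x ≤ L) (hVm : ∀ x, m ≤ V x) (hVL : ∀ x, V x ≤ L)
    (h : ∀ x ∈ Icc (0 : Fin n → ℝ) 1, ∀ y ∈ Icc (0 : Fin n → ℝ) 1,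
      F x ^ (1 - s) * V y ^ s * Real.exp (-(2 / 9 * s * ∑ i, (x i - y i) ^ 2)) ≤
        H ((1 - s) • x + s • y)) :
    (∫ x in Icc (0 : Fin n → ℝ) 1, F x) ^ (1 - s) * (∫ x in Icc (0 : Fin n → ℝ) 1, V x) ^ s ≤
      ∫ x in Icc (0 : Fin n → ℝ) 1, H x := by
  induction n with
  | zero =>
    have hpt : ∀ G : (Fin 0 → ℝ) → ℝ, ∫ x in Icc (0 : Fin 0 → ℝ) 1, G x = G 0 := by
      intro G
      have : G = fun _ => G 0 := by
        ext x
        rw [Subsingleton.elim x 0]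
      rw [this, setIntegral_const, volume_real_Icc_zero_one, one_smul]
    have h0 : (0 : Fin 0 → ℝ) ∈ Icc (0 : Fin 0 → ℝ) 1 := by simp
    rw [hpt, hpt, hpt]
    simpa using h 0 h0 0 h0
  | succ n ih =>
    rw [integral_Icc_succ hF, integral_Icc_succ hV, integral_Icc_succ hH]
    have bd : ∀ G : (Fin (n + 1) → ℝ) → ℝ, Continuous G → (∀ x, m ≤ G x) → (∀ x, G x ≤ L) →
        ∀ x : ℝ, m ≤ ∫ y in Icc (0 : Fin n → ℝ) 1, G (Fin.cons x y) ∧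
          ∫ y in Icc (0 : Fin n → ℝ) 1, G (Fin.cons x y) ≤ L := fun G hG h1 h2 x =>
      setIntegral_Icc_mem_of_bounds (F := fun y => G (Fin.cons x y)) (by fun_prop)
        (fun y => h1 _) (fun y => h2 _)
    refine prekopaLeindler_cost_unitInterval (continuous_integral_cons hF)
      (continuous_integral_cons hV) (continuous_integral_cons hH) (hc.marginal hF) hm
      (fun x => (bd F hF hFm hFL x).1) (fun x => (bd F hF hFm hFL x).2)
      (fun x => (bd V hV hVm hVL x).1) (fun x => (bd V hV hVm hVL x).2) hs hsR ?_
    intro x hx y hy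
    set C := Real.exp (-(2 / 9 * s * (x - y) ^ 2)) with hC
    have hC0 : 0 < C := Real.exp_pos _
    have := ih (F := fun u => F (Fin.cons x u)) (V := fun u => V (Fin.cons y u))
      (H := fun u => H (Fin.cons ((1 - s) * x + s * y) u) / C) (by fun_prop) (by fun_prop)
      (by fun_prop) (hc.cons hx) (fun _ => hFm _) (fun _ => hFL _) (fun _ => hVm _)
      (fun _ => hVL _) ?_
    · rw [integral_div, le_div_iff₀ hC0] at this
      exact this
    · intro u hu w hw
      rw [le_div_iff₀ hC0]
      have h1 := h (Fin.cons x u) (cons_mem_Icc_zero_one.2 ⟨hx, hu⟩) (Fin.cons y w)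
        (cons_mem_Icc_zero_one.2 ⟨hy, hw⟩)
      have e1 : (1 - s) • (Fin.cons x u : Fin (n + 1) → ℝ) + s • Fin.cons y w =
          Fin.cons ((1 - s) * x + s * y) ((1 - s) • u + s • w) := by
        ext i
        refine Fin.cases ?_ (fun j => ?_) i <;> simp
      rw [e1] at h1
      refine le_trans (le_of_eq ?_) h1
      rw [hC, mul_assoc, ← Real.exp_add, Fin.sum_univ_succ]
      simp only [Fin.cons_zero, Fin.cons_succ]
      congr 2
      ring

/-! ### Concentration for positive densities -/

/-- Log-concavity on the unit cube, in multiplicative form. -/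
def CubeLogConcave {n : ℕ} (f : (Fin n → ℝ) → ℝ) : Prop :=
  ∀ x ∈ Icc (0 : Fin n → ℝ) 1, ∀ y ∈ Icc (0 : Fin n → ℝ) 1, ∀ s : ℝ, 0 < s → s < 1 →
    f x ^ (1 - s) * f y ^ s ≤ f ((1 - s) • x + s • y)

lemma exp_neg_le_one_sub_add_sq {u : ℝ} (hu : 0 ≤ u) : Real.exp (-u) ≤ 1 - u + u ^ 2 := by
  rw [Real.exp_neg, inv_le_iff_one_le_mul₀ (Real.exp_pos u)]
  have := Real.add_one_le_exp u
  nlinarith [pow_nonneg hu 3, mul_nonneg (sub_nonneg.2 this)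
    (by nlinarith [sq_nonneg (u - 1 / 2)] : 0 ≤ 1 - u + u ^ 2)]

lemma sq_le_of_le_add {w t a b : ℝ} (hw : 0 ≤ w) (hwt : w ≤ t) (ha : 0 ≤ a) (hb : 0 ≤ b)
    (h : w ≤ a + b) : w ^ 2 ≤ 2 * t * a + b ^ 2 := by
  rcases le_total w b with h1 | h1
  · nlinarith [mul_nonneg (hw.trans hwt) ha]
  · nlinarith [mul_le_mul_of_nonneg_right (show w - b ≤ a by linarith) (add_nonneg hw hb)]

/-- Concentration for a positive density on the cube, with a truncated distance function `d` in the
place of a set.  The Prékopa–Leindler inequality is applied with `F = f`,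
`V = f * exp (-(4 / 9) * t * d)` and `H = f * exp (-(2 / 9) * s * d ^ 2)`, and `s → 0`. -/
theorem integral_exp_neg_dist_le_of_pos {n : ℕ} {f d : (Fin n → ℝ) → ℝ} {m L t : ℝ} (hm : 0 < m)
    (hf : Continuous f) (hc : CoordConvex f) (hl : CubeLogConcave f) (hfm : ∀ x, m ≤ f x)
    (hfL : ∀ x, f x ≤ L) (hd : Continuous d) (hd0 : ∀ x, 0 ≤ d x) (hdt : ∀ x, d x ≤ t)
    (hdl : ∀ x y, d x ≤ d y + √(∑ i, (x i - y i) ^ 2)) :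
    ∫ x in Icc (0 : Fin n → ℝ) 1, f x * Real.exp (-(4 / 9 * t * d x)) ≤
      (∫ x in Icc (0 : Fin n → ℝ) 1, f x) * Real.exp (-(2 / 9 *
        (∫ x in Icc (0 : Fin n → ℝ) 1, f x * d x ^ 2) / ∫ x in Icc (0 : Fin n → ℝ) 1, f x)) := by
  have ht : 0 ≤ t := (hd0 0).trans (hdt 0)
  have hf0 : ∀ x, 0 < f x := fun x => hm.trans_le (hfm x)
  set V : (Fin n → ℝ) → ℝ := fun x => f x * Real.exp (-(4 / 9 * t * d x)) with hV
  have hVc : Continuous V := by fun_prop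
  set m' := m * Real.exp (-(4 / 9 * t * t)) with hm'
  have hm'0 : 0 < m' := mul_pos hm (Real.exp_pos _)
  have hm'm : m' ≤ m := by
    rw [hm']
    exact mul_le_of_le_one_right hm.le (Real.exp_le_one_iff.2 (by nlinarith))
  have hVm : ∀ x, m' ≤ V x := by
    intro x
    have := hdt x
    have := hf0 x
    simp only [hV, hm']
    gcongr
    exact hfm x
  have hVL : ∀ x, V x ≤ L := by
    intro x
    refine le_trans ?_ (hfL x)
    exact mul_le_of_le_one_right (hf0 x).le
      (Real.exp_le_one_iff.2 (by have := mul_nonneg ht (hd0 x); linarith))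
  have hint : ∀ g : (Fin n → ℝ) → ℝ, Continuous g → IntegrableOn g (Icc (0 : Fin n → ℝ) 1) :=
    fun g hg => hg.continuousOn.integrableOn_compact isCompact_Icc
  set Z := ∫ x in Icc (0 : Fin n → ℝ) 1, f x with hZ
  set D := ∫ x in Icc (0 : Fin n → ℝ) 1, f x * d x ^ 2 with hD
  set W := ∫ x in Icc (0 : Fin n → ℝ) 1, V x with hW
  have hZ0 : 0 < Z := hm.trans_le (setIntegral_Icc_mem_of_bounds hf hfm hfL).1
  have hW0 : 0 < W := hm'0.trans_le (setIntegral_Icc_mem_of_bounds hVc hVm hVL).1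
  have hmL : m' ≤ L := hm'm.trans ((hfm 0).trans (hfL 0))
  set K := entropyConst ((L / m') ^ 2) with hK
  have hK1 : 1 ≤ K := one_le_entropyConst (one_le_pow₀ ((one_le_div hm'0).2 hmL))
  have step : ∀ s : ℝ, 0 < s → s * K ≤ 1 / 18 →
      Real.log (W / Z) ≤ -(2 / 9 * D / Z) + s * ((2 / 9) ^ 2 * t ^ 4) := by
    intro s hs hsK
    have hs1 : s ≤ 1 / 18 := by nlinarith
    have hPL := prekopaLeindler_cost_cube hm'0 hs hsK n hf hVc
      (H := fun x => f x * Real.exp (-(2 / 9 * s * d x ^ 2))) (by fun_prop) hc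
      (fun x => hm'm.trans (hfm x)) hfL hVm hVL ?_
    · have hH : ∫ x in Icc (0 : Fin n → ℝ) 1, f x * Real.exp (-(2 / 9 * s * d x ^ 2)) ≤
          Z - s * (2 / 9 * D) + s ^ 2 * ((2 / 9) ^ 2 * t ^ 4) * Z := by
        have e : Z - s * (2 / 9 * D) + s ^ 2 * ((2 / 9) ^ 2 * t ^ 4) * Z =
            ∫ x in Icc (0 : Fin n → ℝ) 1, (f x - s * (2 / 9 * (f x * d x ^ 2)) +
              s ^ 2 * ((2 / 9) ^ 2 * t ^ 4) * f x) := by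
          rw [integral_add (hint _ (by fun_prop)) (hint _ (by fun_prop)),
            integral_sub (hint _ (by fun_prop)) (hint _ (by fun_prop)), integral_const_mul,
            integral_const_mul, integral_const_mul]
        rw [e]
        apply setIntegral_mono (hint _ (by fun_prop)) (hint _ (by fun_prop))
        intro x
        have h1 := exp_neg_le_one_sub_add_sq
          (show 0 ≤ 2 / 9 * s * d x ^ 2 by have := hd0 x; positivity)
        have h2 : d x ^ 4 ≤ t ^ 4 := by
          have := hd0 x
          have := hdt x
          gcongr
        calc f x * Real.exp (-(2 / 9 * s * d x ^ 2))
            ≤ f x * (1 - 2 / 9 * s * d x ^ 2 + (2 / 9 * s) ^ 2 * t ^ 4) := by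
              apply mul_le_mul_of_nonneg_left _ (hf0 x).le
              refine h1.trans ?_
              have := mul_le_mul_of_nonneg_left h2 (sq_nonneg (2 / 9 * s))
              linarith
          _ = _ := by ring
      have h3 := hPL.trans hH
      have h4 : Z ^ (1 - s) * W ^ s = Z * (W / Z) ^ s := by
        rw [Real.div_rpow hW0.le hZ0.le, Real.rpow_sub hZ0, Real.rpow_one]
        ring
      rw [h4] at h3
      have h5 : (W / Z) ^ s ≤ 1 + s * (-(2 / 9 * D / Z) + s * ((2 / 9) ^ 2 * t ^ 4)) := by
        rw [← mul_le_mul_iff_right₀ hZ0]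
        refine h3.trans (le_of_eq ?_)
        field_simp
        ring
      have h6 := Real.log_le_sub_one_of_pos (Real.rpow_pos_of_pos (div_pos hW0 hZ0) s)
      rw [Real.log_rpow (div_pos hW0 hZ0)] at h6
      have h7 : s * Real.log (W / Z) ≤
          s * (-(2 / 9 * D / Z) + s * ((2 / 9) ^ 2 * t ^ 4)) := by linarith
      exact le_of_mul_le_mul_left h7 hs
    · intro x hx y hy
      set z := (1 - s) • x + s • y with hz
      have hfz := hl x hx y hy s hs (by linarith)
      have hb := Real.sqrt_nonneg (∑ i, (x i - y i) ^ 2)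
      have hbz : √(∑ i, (z i - y i) ^ 2) ≤ √(∑ i, (x i - y i) ^ 2) := by
        apply Real.sqrt_le_sqrt
        apply Finset.sum_le_sum
        intro i _
        have : z i - y i = (1 - s) * (x i - y i) := by simp [hz]; ring
        rw [this, mul_pow]
        exact mul_le_of_le_one_left (sq_nonneg _) (by nlinarith)
      have hdz := sq_le_of_le_add (hd0 z) (hdt z) (hd0 y) hb ((hdl z y).trans (by linarith))
      rw [Real.sq_sqrt (by positivity)] at hdz
      have hexp : Real.exp (-(4 / 9 * t * d y)) ^ s *
          Real.exp (-(2 / 9 * s * ∑ i, (x i - y i) ^ 2)) ≤ Real.exp (-(2 / 9 * s * d z ^ 2)) := by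
        rw [← Real.exp_mul, ← Real.exp_add]
        apply Real.exp_le_exp.2
        nlinarith
      calc f x ^ (1 - s) * V y ^ s * Real.exp (-(2 / 9 * s * ∑ i, (x i - y i) ^ 2))
          = (f x ^ (1 - s) * f y ^ s) * (Real.exp (-(4 / 9 * t * d y)) ^ s *
            Real.exp (-(2 / 9 * s * ∑ i, (x i - y i) ^ 2))) := by
            simp only [hV]
            rw [Real.mul_rpow (hf0 y).le (Real.exp_pos _).le]
            ring
        _ ≤ f z * Real.exp (-(2 / 9 * s * d z ^ 2)) :=
            mul_le_mul hfz hexp (by positivity) (hf0 z).le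
  have hlog : Real.log (W / Z) ≤ -(2 / 9 * D / Z) := by
    apply le_of_forall_pos_le_add
    intro ε hε
    set C := (2 / 9) ^ 2 * t ^ 4 with hC
    have hC0 : 0 ≤ C := by positivity
    set s := min (1 / (18 * K)) (ε / (C + 1)) with hs
    have hs0 : 0 < s := lt_min (by positivity) (by positivity)
    have hsK : s * K ≤ 1 / 18 := by
      calc s * K ≤ 1 / (18 * K) * K := by gcongr; exact min_le_left _ _
        _ = 1 / 18 := by field_simp
    have hsC : s * C ≤ ε := by
      calc s * C ≤ s * (C + 1) := by gcongr; linarith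
        _ ≤ ε / (C + 1) * (C + 1) := by gcongr; exact min_le_right _ _
        _ = ε := by field_simp
    linarith [step s hs0 hsK]
  have := (Real.log_le_iff_le_exp (div_pos hW0 hZ0)).1 hlog
  rwa [div_le_iff₀ hZ0, mul_comm] at this

/-! ### Regularization of densities -/

lemma update_mem_Icc_zero_one {n : ℕ} {x : Fin n → ℝ} (hx : x ∈ Icc (0 : Fin n → ℝ) 1) (i : Fin n)
    {τ : ℝ} (hτ : τ ∈ Icc (0 : ℝ) 1) : Function.update x i τ ∈ Icc (0 : Fin n → ℝ) 1 := by
  constructor <;> intro j <;> by_cases h : j = i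
  · subst h; simpa using hτ.1
  · simpa [h] using hx.1 j
  · subst h; simpa using hτ.2
  · simpa [h] using hx.2 j

lemma CoordConvex.congr {n : ℕ} {F G : (Fin n → ℝ) → ℝ} (hF : CoordConvex F)
    (h : ∀ x ∈ Icc (0 : Fin n → ℝ) 1, F x = G x) : CoordConvex G := fun x hx i =>
  (hF x hx i).congr fun _ hτ => h _ (update_mem_Icc_zero_one hx i hτ)

lemma CubeLogConcave.congr {n : ℕ} {f g : (Fin n → ℝ) → ℝ} (hf : CubeLogConcave f)
    (h : ∀ x ∈ Icc (0 : Fin n → ℝ) 1, f x = g x) : CubeLogConcave g := by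
  intro x hx y hy s h0 h1
  rw [← h x hx, ← h y hy, ← h _ (convex_Icc _ _ hx hy (by linarith) h0.le (by ring))]
  exact hf x hx y hy s h0 h1

/-- The coordinatewise nearest-point retraction onto the unit cube. -/
def cubeClamp {n : ℕ} (x : Fin n → ℝ) : Fin n → ℝ := fun i => max 0 (min 1 (x i))

lemma continuous_cubeClamp {n : ℕ} : Continuous (cubeClamp : (Fin n → ℝ) → _) := by
  unfold cubeClamp
  fun_prop

lemma cubeClamp_mem {n : ℕ} (x : Fin n → ℝ) : cubeClamp x ∈ Icc (0 : Fin n → ℝ) 1 :=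
  ⟨fun _ => le_max_left _ _, fun _ => max_le zero_le_one (min_le_left _ _)⟩

lemma cubeClamp_of_mem {n : ℕ} {x : Fin n → ℝ} (hx : x ∈ Icc (0 : Fin n → ℝ) 1) :
    cubeClamp x = x := by
  ext i
  have h1 : x i ≤ 1 := hx.2 i
  have h0 : 0 ≤ x i := hx.1 i
  simp [cubeClamp, h1, h0]

/-- The regularization `x ↦ sup_y f y * exp (-K * ‖x - y‖₁)` of `f` over the unit cube: in terms of
`-log f` it is the infimal convolution with `K` times the `ℓ¹`-norm.  It is positive, and with the
`ℓ¹`-norm it preserves convexity along the coordinate directions. -/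
noncomputable def expReg {n : ℕ} (K : ℝ) (f : (Fin n → ℝ) → ℝ) (x : Fin n → ℝ) : ℝ :=
  sSup ((fun y => f y * Real.exp (-(K * ∑ i, |x i - y i|))) '' Icc 0 1)

section expReg

variable {n : ℕ} {K : ℝ} {f : (Fin n → ℝ) → ℝ}

lemma exists_expReg_eq (hf : Continuous f) (x : Fin n → ℝ) :
    ∃ y ∈ Icc (0 : Fin n → ℝ) 1, expReg K f x = f y * Real.exp (-(K * ∑ i, |x i - y i|)) :=
  isCompact_Icc.exists_sSup_image_eq ⟨0, by simp⟩ (by fun_prop)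

lemma le_expReg (hf : Continuous f) (x : Fin n → ℝ) {y : Fin n → ℝ}
    (hy : y ∈ Icc (0 : Fin n → ℝ) 1) :
    f y * Real.exp (-(K * ∑ i, |x i - y i|)) ≤ expReg K f x :=
  le_csSup (isCompact_Icc.bddAbove_image (by fun_prop)) (mem_image_of_mem _ hy)

lemma self_le_expReg (hf : Continuous f) {x : Fin n → ℝ} (hx : x ∈ Icc (0 : Fin n → ℝ) 1) :
    f x ≤ expReg K f x := by
  simpa using le_expReg (K := K) hf x hx

lemma continuous_expReg (hf : Continuous f) : Continuous (expReg K f) := by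
  unfold expReg
  apply isCompact_Icc.continuous_sSup
  simp only [Function.HasUncurry.uncurry, id]
  fun_prop

lemma expReg_le (hf : Continuous f) (hK : 0 ≤ K) {L : ℝ} (h0 : ∀ x, 0 ≤ f x) (hL : ∀ x, f x ≤ L)
    (x : Fin n → ℝ) : expReg K f x ≤ L := by
  obtain ⟨y, -, h⟩ := exists_expReg_eq (K := K) hf x
  rw [h]
  refine (mul_le_of_le_one_right (h0 y) (Real.exp_le_one_iff.2 ?_)).trans (hL y)
  have : 0 ≤ ∑ i, |x i - y i| := Finset.sum_nonneg fun _ _ => abs_nonneg _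
  nlinarith

lemma expReg_lower_bound (hf : Continuous f) (hK : 0 ≤ K) {x y : Fin n → ℝ} (hy0 : 0 ≤ f y)
    (hx : x ∈ Icc (0 : Fin n → ℝ) 1) (hy : y ∈ Icc (0 : Fin n → ℝ) 1) :
    f y * Real.exp (-(K * n)) ≤ expReg K f x := by
  refine le_trans ?_ (le_expReg hf x hy)
  gcongr
  calc ∑ i, |x i - y i| ≤ ∑ _i : Fin n, (1 : ℝ) := by
        apply Finset.sum_le_sum
        intro i _
        have h1 : x i ≤ 1 := hx.2 i
        have h2 : y i ≤ 1 := hy.2 i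
        have h3 : 0 ≤ x i := hx.1 i
        have h4 : 0 ≤ y i := hy.1 i
        rw [abs_le]
        constructor <;> linarith
    _ = n := by simp

lemma CubeLogConcave.expReg (hf : Continuous f) (h0 : ∀ x, 0 ≤ f x) (hK : 0 ≤ K)
    (hl : CubeLogConcave f) : CubeLogConcave (expReg K f) := by
  intro x _ x' _ s hs0 hs1
  obtain ⟨y, hy, e⟩ := exists_expReg_eq (K := K) hf x
  obtain ⟨y', hy', e'⟩ := exists_expReg_eq (K := K) hf x'
  have hmem := convex_Icc (0 : Fin n → ℝ) 1 hy hy' (by linarith : 0 ≤ 1 - s) hs0.le (by ring)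
  refine le_trans ?_ (le_expReg hf _ hmem)
  rw [e, e', Real.mul_rpow (h0 _) (Real.exp_pos _).le, Real.mul_rpow (h0 _) (Real.exp_pos _).le,
    ← Real.exp_mul, ← Real.exp_mul]
  set S := ∑ i, |x i - y i|
  set S' := ∑ i, |x' i - y' i|
  have hsum : ∑ i, |((1 - s) • x + s • x') i - ((1 - s) • y + s • y') i| ≤
      (1 - s) * S + s * S' := by
    rw [Finset.mul_sum, Finset.mul_sum, ← Finset.sum_add_distrib]
    apply Finset.sum_le_sum
    intro i _
    have e : ((1 - s) • x + s • x') i - ((1 - s) • y + s • y') i =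
        (1 - s) * (x i - y i) + s * (x' i - y' i) := by simp; ring
    rw [e]
    refine (abs_add_le _ _).trans (le_of_eq ?_)
    rw [abs_mul, abs_mul, abs_of_pos hs0, abs_of_pos (by linarith : 0 < 1 - s)]
  calc f y ^ (1 - s) * Real.exp (-(K * S) * (1 - s)) * (f y' ^ s * Real.exp (-(K * S') * s))
      = f y ^ (1 - s) * f y' ^ s * Real.exp (-(K * ((1 - s) * S + s * S'))) := by
        rw [show -(K * ((1 - s) * S + s * S')) = -(K * S) * (1 - s) + -(K * S') * s by ring,
          Real.exp_add]
        ring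
    _ ≤ _ := mul_le_mul (hl y hy y' hy' s hs0 hs1) (by gcongr) (Real.exp_pos _).le (h0 _)

lemma mul_exp_le_affine {C κ u v p q z : ℝ} (hC : 0 ≤ C) (hp : C * Real.exp (κ * p) ≤ u * p + v)
    (hq : C * Real.exp (κ * q) ≤ u * q + v) (hpz : p ≤ z) (hzq : z ≤ q) :
    C * Real.exp (κ * z) ≤ u * z + v := by
  rcases (hpz.trans hzq).eq_or_lt with rfl | hlt
  · obtain rfl : z = p := le_antisymm hzq hpz
    exact hp
  have hqp : 0 < q - p := by linarith
  have hα : 0 ≤ (q - z) / (q - p) := div_nonneg (by linarith) hqp.le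
  have hβ : 0 ≤ (z - p) / (q - p) := div_nonneg (by linarith) hqp.le
  have hαβ : (q - z) / (q - p) + (z - p) / (q - p) = 1 := by field_simp; ring
  have hz : (q - z) / (q - p) * p + (z - p) / (q - p) * q = z := by field_simp; ring
  have h := convexOn_exp.2 (mem_univ (κ * p)) (mem_univ (κ * q)) hα hβ hαβ
  simp only [smul_eq_mul] at h
  set α := (q - z) / (q - p)
  set β := (z - p) / (q - p)
  calc C * Real.exp (κ * z) = C * Real.exp (α * (κ * p) + β * (κ * q)) := by
        rw [← hz]; ring_nf
    _ ≤ C * (α * Real.exp (κ * p) + β * Real.exp (κ * q)) := by gcongr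
    _ = α * (C * Real.exp (κ * p)) + β * (C * Real.exp (κ * q)) := by ring
    _ ≤ α * (u * p + v) + β * (u * q + v) := by gcongr
    _ = u * (α * p + β * q) + (α + β) * v := by ring
    _ = u * z + v := by rw [hz, hαβ, one_mul]

/-- A two-sided exponential peak at `y` stays below an affine function on `[a, b]` if it does so at
`a`, at `b`, and at its apex. -/
lemma peak_le_affine {G K u v a b y z : ℝ} (hG : 0 ≤ G)
    (ha : G * Real.exp (-(K * |a - y|)) ≤ u * a + v)
    (hb : G * Real.exp (-(K * |b - y|)) ≤ u * b + v)
    (hy : a < y → y < b → G ≤ u * y + v) (haz : a ≤ z) (hzb : z ≤ b) :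
    G * Real.exp (-(K * |z - y|)) ≤ u * z + v := by
  have right : ∀ τ, y ≤ τ → G * Real.exp (-(K * |τ - y|)) =
      G * Real.exp (K * y) * Real.exp (-K * τ) := by
    intro τ h
    rw [abs_of_nonneg (by linarith), mul_assoc, ← Real.exp_add]
    ring_nf
  have left : ∀ τ, τ ≤ y → G * Real.exp (-(K * |τ - y|)) =
      G * Real.exp (-K * y) * Real.exp (K * τ) := by
    intro τ h
    rw [abs_of_nonpos (by linarith), mul_assoc, ← Real.exp_add]
    ring_nf
  have hpos : ∀ κ, 0 ≤ G * Real.exp κ := fun κ => mul_nonneg hG (Real.exp_pos _).le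
  have apex : a < y → y < b → G * Real.exp (-(K * |y - y|)) ≤ u * y + v := by simpa using hy
  rcases le_or_gt y a with h1 | h1
  · rw [right _ h1] at ha
    rw [right _ (by linarith)] at hb ⊢
    exact mul_exp_le_affine (hpos _) ha hb haz hzb
  rcases le_or_gt b y with h2 | h2
  · rw [left _ h2] at hb
    rw [left _ (by linarith)] at ha ⊢
    exact mul_exp_le_affine (hpos _) ha hb haz hzb
  have hap := apex h1 h2
  rcases le_total z y with h3 | h3
  · rw [left _ h1.le] at ha
    rw [left _ le_rfl] at hap
    rw [left _ h3]
    exact mul_exp_le_affine (hpos _) ha hap haz h3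
  · rw [right _ h2.le] at hb
    rw [right _ le_rfl] at hap
    rw [right _ h3]
    exact mul_exp_le_affine (hpos _) hap hb h3 hzb

lemma CoordConvex.expReg (hf : Continuous f) (h0 : ∀ x, 0 ≤ f x) (hc : CoordConvex f) :
    CoordConvex (expReg K f) := by
  intro x hx i
  apply LinearOrder.convexOn_of_lt (convex_Icc 0 1)
  intro a ha b hb hab α β hα hβ hαβ
  simp only [smul_eq_mul]
  set z := α * a + β * b with hz
  obtain ⟨y, hy, e⟩ := exists_expReg_eq (K := K) hf (Function.update x i z)
  set C := Real.exp (-(K * ∑ j ∈ Finset.univ.erase i, |x j - y j|)) with hC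
  have hC0 : 0 < C := Real.exp_pos _
  have split : ∀ τ w : ℝ, f (Function.update y i w) *
      Real.exp (-(K * ∑ j, |Function.update x i τ j - Function.update y i w j|)) =
        C * (f (Function.update y i w) * Real.exp (-(K * |τ - w|))) := by
    intro τ w
    rw [← Finset.add_sum_erase _ _ (Finset.mem_univ i)]
    have : ∑ j ∈ Finset.univ.erase i, |Function.update x i τ j - Function.update y i w j| =
        ∑ j ∈ Finset.univ.erase i, |x j - y j| := by
      apply Finset.sum_congr rfl
      intro j hj
      have hji : j ≠ i := Finset.ne_of_mem_erase hj
      simp [hji]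
    rw [this, hC, Function.update_self, Function.update_self, mul_add, neg_add, Real.exp_add]
    ring
  have lower : ∀ τ, ∀ w ∈ Icc (0 : ℝ) 1, C * (f (Function.update y i w) *
      Real.exp (-(K * |τ - w|))) ≤ _root_.expReg K f (Function.update x i τ) := by
    intro τ w hw
    rw [← split]
    exact le_expReg hf _ (update_mem_Icc_zero_one hy i hw)
  have hyi : y i ∈ Icc (0 : ℝ) 1 := ⟨hy.1 i, hy.2 i⟩
  have e2 : _root_.expReg K f (Function.update x i z) =
      C * (f y * Real.exp (-(K * |z - y i|))) := by
    have := split z (y i)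
    rw [Function.update_eq_self] at this
    rw [e, this]
  set A := _root_.expReg K f (Function.update x i a) with hA
  set B := _root_.expReg K f (Function.update x i b) with hB
  have hba : 0 < b - a := by linarith
  -- the chord of the regularization over `[a, b]`
  set u := (B - A) / (b - a) with hu
  have hub : u * (b - a) = B - A := by rw [hu]; field_simp
  have ea : u * a + (A - u * a) = A := by ring
  have eb : u * b + (A - u * a) = B := by linear_combination hub
  have ez : u * z + (A - u * a) = α * A + β * B := by
    have hα' : α = 1 - β := by linarith
    rw [hz, hα']
    linear_combination β * hub
  have hself : f (Function.update y i (y i)) = f y := by rw [Function.update_eq_self]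
  rw [e2, ← mul_assoc, ← ez]
  apply peak_le_affine (mul_nonneg hC0.le (h0 y)) (a := a) (b := b)
  · rw [ea, mul_assoc, ← hself]
    exact lower a (y i) hyi
  · rw [eb, mul_assoc, ← hself]
    exact lower b (y i) hyi
  · intro h1 h2
    have hw1 : 0 ≤ (b - y i) / (b - a) := div_nonneg (by linarith) hba.le
    have hw2 : 0 ≤ (y i - a) / (b - a) := div_nonneg (by linarith) hba.le
    have hw : (b - y i) / (b - a) + (y i - a) / (b - a) = 1 := by field_simp; ring
    have hconv := (hc y hy i).2 ha hb hw1 hw2 hw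
    simp only [smul_eq_mul] at hconv
    have e3 : (b - y i) / (b - a) * a + (y i - a) / (b - a) * b = y i := by field_simp; ring
    rw [e3, hself] at hconv
    have la := lower a a ha
    have lb := lower b b hb
    simp only [sub_self, abs_zero, mul_zero, neg_zero, Real.exp_zero, mul_one] at la lb
    have e4 : u * y i + (A - u * a) =
        (b - y i) / (b - a) * A + (y i - a) / (b - a) * B := by
      rw [hu]; field_simp; ring
    rw [e4]
    calc C * f y ≤ C * ((b - y i) / (b - a) * f (Function.update y i a) +
          (y i - a) / (b - a) * f (Function.update y i b)) := by gcongr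
      _ = (b - y i) / (b - a) * (C * f (Function.update y i a)) +
          (y i - a) / (b - a) * (C * f (Function.update y i b)) := by ring
      _ ≤ _ := by gcongr
  · have : α * a + β * a = a := by rw [← add_mul, hαβ, one_mul]
    nlinarith
  · have : α * b + β * b = b := by rw [← add_mul, hαβ, one_mul]
    nlinarith

lemma tendsto_expReg (hf : Continuous f) {L : ℝ} (h0 : ∀ x, 0 ≤ f x) (hL : ∀ x, f x ≤ L)
    {x : Fin n → ℝ} (hx : x ∈ Icc (0 : Fin n → ℝ) 1) :
    Filter.Tendsto (fun k : ℕ => expReg k f x) Filter.atTop (nhds (f x)) := by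
  rw [Metric.tendsto_atTop]
  intro ε hε
  obtain ⟨δ, hδ, hfδ⟩ := Metric.continuousAt_iff.1 (hf.continuousAt (x := x)) (ε / 2) (by positivity)
  have hlim : Filter.Tendsto (fun k : ℕ => L * Real.exp (-((k : ℝ) * δ))) Filter.atTop
      (nhds (L * 0)) := by
    apply Filter.Tendsto.const_mul
    apply Real.tendsto_exp_atBot.comp
    exact Filter.tendsto_neg_atTop_atBot.comp
      (tendsto_natCast_atTop_atTop.atTop_mul_const hδ)
  rw [mul_zero] at hlim
  obtain ⟨N, hN⟩ := Filter.eventually_atTop.1 (hlim.eventually (gt_mem_nhds (half_pos hε)))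
  refine ⟨N, fun k hk => ?_⟩
  have hge := self_le_expReg (K := k) hf hx
  obtain ⟨y, hy, e⟩ := exists_expReg_eq (K := (k : ℝ)) hf x
  rw [Real.dist_eq, abs_of_nonneg (by linarith)]
  have hsum : 0 ≤ ∑ i, |x i - y i| := Finset.sum_nonneg fun _ _ => abs_nonneg _
  have hk0 : (0 : ℝ) ≤ k := k.cast_nonneg
  by_cases hxy : dist y x < δ
  · have h1 := hfδ hxy
    rw [Real.dist_eq, abs_lt] at h1
    have h2 : expReg k f x ≤ f y := by
      rw [e]
      exact mul_le_of_le_one_right (h0 y) (Real.exp_le_one_iff.2 (by nlinarith))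
    linarith
  · have h1 : δ ≤ ∑ i, |x i - y i| := by
      refine (not_lt.1 hxy).trans ?_
      rw [dist_comm, dist_pi_le_iff hsum]
      intro i
      rw [Real.dist_eq]
      exact Finset.single_le_sum (f := fun i => |x i - y i|) (fun _ _ => abs_nonneg _)
        (Finset.mem_univ i)
    have h2 : expReg k f x ≤ L * Real.exp (-((k : ℝ) * δ)) := by
      rw [e]
      have := hL y
      have := (h0 y).trans this
      gcongr
    have h3 := hN k hk
    have := h0 x
    linarith

end expReg

/-! ### Densities with zeros and on the open cube -/

/-- The estimate of `integral_exp_neg_dist_le_of_pos` for continuous densities that may vanish. -/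
theorem integral_exp_neg_dist_le_of_continuous {n : ℕ} {f d : (Fin n → ℝ) → ℝ} {L t : ℝ}
    (hf : Continuous f) (hc : CoordConvex f) (hl : CubeLogConcave f) (h0 : ∀ x, 0 ≤ f x)
    (hfL : ∀ x, f x ≤ L) (hpos : 0 < ∫ x in Icc (0 : Fin n → ℝ) 1, f x)
    (hd : Continuous d) (hd0 : ∀ x, 0 ≤ d x) (hdt : ∀ x, d x ≤ t)
    (hdl : ∀ x y, d x ≤ d y + √(∑ i, (x i - y i) ^ 2)) :
    ∫ x in Icc (0 : Fin n → ℝ) 1, f x * Real.exp (-(4 / 9 * t * d x)) ≤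
      (∫ x in Icc (0 : Fin n → ℝ) 1, f x) * Real.exp (-(2 / 9 *
        (∫ x in Icc (0 : Fin n → ℝ) 1, f x * d x ^ 2) / ∫ x in Icc (0 : Fin n → ℝ) 1, f x)) := by
  obtain ⟨y, hy, hfy⟩ : ∃ y ∈ Icc (0 : Fin n → ℝ) 1, 0 < f y := by
    by_contra! h
    exact hpos.not_ge (setIntegral_nonpos measurableSet_Icc h)
  set g : ℕ → (Fin n → ℝ) → ℝ := fun k x => expReg k f (cubeClamp x) with hg
  have hgc : ∀ k, Continuous (g k) := fun k => (continuous_expReg hf).comp continuous_cubeClamp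
  have hgL : ∀ k x, g k x ≤ L := fun k x => expReg_le hf k.cast_nonneg h0 hfL _
  have hg0 : ∀ k x, 0 ≤ g k x := fun k x => (h0 _).trans (self_le_expReg hf (cubeClamp_mem x))
  have heq : ∀ k : ℕ, ∀ x ∈ Icc (0 : Fin n → ℝ) 1, expReg k f x = g k x := fun k x hx => by
    simp only [hg, cubeClamp_of_mem hx]
  have main := fun k : ℕ => integral_exp_neg_dist_le_of_pos (f := g k) (d := d) (t := t)
    (m := f y * Real.exp (-(k * n))) (L := L) (mul_pos hfy (Real.exp_pos _)) (hgc k)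
    ((hc.expReg hf h0).congr (heq k)) ((hl.expReg hf h0 k.cast_nonneg).congr (heq k))
    (fun x => expReg_lower_bound hf k.cast_nonneg hfy.le (cubeClamp_mem x) hy) (hgL k) hd hd0 hdt
    hdl
  have lim : ∀ ψ : (Fin n → ℝ) → ℝ, Continuous ψ → Filter.Tendsto
      (fun k => ∫ x in Icc (0 : Fin n → ℝ) 1, g k x * ψ x) Filter.atTop
      (nhds (∫ x in Icc (0 : Fin n → ℝ) 1, f x * ψ x)) := by
    intro ψ hψ
    apply tendsto_integral_of_dominated_convergence fun x => L * |ψ x|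
    · exact fun k => ((hgc k).mul hψ).aestronglyMeasurable
    · exact ContinuousOn.integrableOn_compact isCompact_Icc (by fun_prop)
    · intro k
      filter_upwards with x
      rw [Real.norm_eq_abs, abs_mul, abs_of_nonneg (hg0 k x)]
      gcongr
      exact hgL k x
    · filter_upwards [ae_restrict_mem measurableSet_Icc] with x hx
      apply Filter.Tendsto.mul_const
      simp only [hg, cubeClamp_of_mem hx]
      exact tendsto_expReg hf h0 hfL hx
  have l1 := lim (fun x => Real.exp (-(4 / 9 * t * d x))) (by fun_prop)
  have l2 := lim (fun x => d x ^ 2) (by fun_prop)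
  have l3 := lim (fun _ => 1) continuous_const
  simp only [mul_one] at l3
  refine le_of_tendsto_of_tendsto' l1 ?_ main
  exact l3.mul ((Real.continuous_exp.tendsto _).comp
    (((l2.const_mul (2 / 9)).div l3 hpos.ne').neg))

lemma setIntegral_Icc_comp_affine {n : ℕ} (g : (Fin n → ℝ) → ℝ) {δ ρ : ℝ} (hρ : 0 < ρ) :
    ∫ x in Icc (0 : Fin n → ℝ) 1, g ((fun _ => δ) + ρ • x) =
      (ρ ^ n)⁻¹ * ∫ x in Icc (fun _ => δ : Fin n → ℝ) (fun _ => δ + ρ), g x := by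
  have h1 := Measure.setIntegral_comp_smul_of_pos (volume : Measure (Fin n → ℝ))
    (fun x => g ((fun _ => δ) + x)) (Icc (0 : Fin n → ℝ) 1) hρ
  rw [h1]
  simp only [Module.finrank_fin_fun, smul_eq_mul]
  congr 1
  have h2 := (measurePreserving_add_left (volume : Measure (Fin n → ℝ))
    (fun _ => δ)).setIntegral_preimage_emb (measurableEmbedding_addLeft _) g
    (Icc (fun _ => δ : Fin n → ℝ) (fun _ => δ + ρ))
  rw [← h2]
  congr 2
  ext x
  rw [mem_smul_set_iff_inv_smul_mem₀ hρ.ne']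
  simp only [mem_Icc, Pi.le_def, mem_preimage, Pi.add_apply, Pi.smul_apply, smul_eq_mul,
    Pi.zero_apply, Pi.one_apply]
  refine and_congr (forall_congr' fun i => ?_) (forall_congr' fun i => ?_)
  · rw [mul_nonneg_iff_of_pos_left (inv_pos.2 hρ)]
    simp
  · rw [inv_mul_le_iff₀ hρ]
    simp

/-- The estimate for a closed concentric subcube of the open unit cube, by rescaling. -/
lemma integral_exp_neg_dist_le_subcube {n : ℕ} {f d : (Fin n → ℝ) → ℝ} {t δ ρ : ℝ} (hδ : 0 < δ)
    (hρ : 0 < ρ) (hδρ : δ + ρ < 1) (hconv : ConvexOn ℝ (univ.pi fun _ => Ioo (0 : ℝ) 1) f)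
    (h0 : ∀ x ∈ univ.pi fun _ : Fin n => Ioo (0 : ℝ) 1, 0 ≤ f x)
    (hl : ∀ x ∈ univ.pi fun _ : Fin n => Ioo (0 : ℝ) 1,
      ∀ y ∈ univ.pi fun _ : Fin n => Ioo (0 : ℝ) 1, ∀ s : ℝ, 0 < s → s < 1 →
        f x ^ (1 - s) * f y ^ s ≤ f ((1 - s) • x + s • y))
    (hpos : 0 < ∫ x in Icc (fun _ => δ : Fin n → ℝ) (fun _ => δ + ρ), f x)
    (hd : Continuous d) (hd0 : ∀ x, 0 ≤ d x) (hdt : ∀ x, d x ≤ t)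
    (hdl : ∀ x y, d x ≤ d y + √(∑ i, (x i - y i) ^ 2)) :
    ∫ x in Icc (fun _ => δ : Fin n → ℝ) (fun _ => δ + ρ), f x * Real.exp (-(4 / 9 * t * d x)) ≤
      (∫ x in Icc (fun _ => δ : Fin n → ℝ) (fun _ => δ + ρ), f x) * Real.exp (-(2 / 9 *
        (∫ x in Icc (fun _ => δ : Fin n → ℝ) (fun _ => δ + ρ), f x * d x ^ 2) /
          ∫ x in Icc (fun _ => δ : Fin n → ℝ) (fun _ => δ + ρ), f x)) := by
  set O : Set (Fin n → ℝ) := univ.pi fun _ => Ioo (0 : ℝ) 1 with hO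
  set J := Icc (fun _ => δ : Fin n → ℝ) (fun _ => δ + ρ) with hJ
  have hρ1 : ρ ≤ 1 := by linarith
  have hOo : IsOpen O := isOpen_set_pi finite_univ fun _ _ => isOpen_Ioo
  have hfc : ContinuousOn f O := hconv.continuousOn hOo
  set φ : (Fin n → ℝ) → (Fin n → ℝ) := fun x => (fun _ => δ) + ρ • x with hφ
  have hφc : Continuous φ := by fun_prop
  have hφO : ∀ x ∈ Icc (0 : Fin n → ℝ) 1, φ x ∈ O := by
    intro x hx i _
    have h1 : x i ≤ 1 := hx.2 i
    have h2 : 0 ≤ x i := hx.1 i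
    simp only [hφ, Pi.add_apply, Pi.smul_apply, smul_eq_mul, mem_Ioo]
    constructor <;> nlinarith
  have hφaff : ∀ x y : Fin n → ℝ, ∀ a b : ℝ, a + b = 1 →
      φ (a • x + b • y) = a • φ x + b • φ y := by
    intro x y a b hab
    ext i
    simp only [hφ, Pi.add_apply, Pi.smul_apply, smul_eq_mul]
    linear_combination (-δ) * hab
  set g : (Fin n → ℝ) → ℝ := fun x => f (φ (cubeClamp x)) with hg
  have hgc : Continuous g :=
    hfc.comp_continuous (hφc.comp continuous_cubeClamp) fun x => hφO _ (cubeClamp_mem x)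
  have hgI : ∀ x ∈ Icc (0 : Fin n → ℝ) 1, f (φ x) = g x := fun x hx => by
    simp only [hg, cubeClamp_of_mem hx]
  have hgO : ∀ x, 0 ≤ g x := fun x => h0 _ (hφO _ (cubeClamp_mem x))
  obtain ⟨L, hL⟩ : ∃ L, ∀ x, g x ≤ L := by
    obtain ⟨L, hL⟩ := (isCompact_Icc (a := (0 : Fin n → ℝ)) (b := 1)).bddAbove_image
      hgc.continuousOn
    refine ⟨L, fun x => ?_⟩
    have := hL (mem_image_of_mem g (cubeClamp_mem x))
    rwa [← hgI _ (cubeClamp_mem x)] at this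
  have hgconv : CoordConvex g := by
    apply CoordConvex.congr (F := fun x => f (φ x)) _ hgI
    intro x hx i
    refine ⟨convex_Icc 0 1, fun a ha b hb α β hα hβ hαβ => ?_⟩
    have e : Function.update x i (α • a + β • b) =
        α • Function.update x i a + β • Function.update x i b := by
      ext j
      by_cases h : j = i
      · subst h; simp
      · simp only [Function.update_of_ne h, Pi.add_apply, Pi.smul_apply, smul_eq_mul]
        rw [← add_mul, hαβ, one_mul]
    simp only
    rw [e, hφaff _ _ _ _ hαβ]
    exact hconv.2 (hφO _ (update_mem_Icc_zero_one hx i ha))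
      (hφO _ (update_mem_Icc_zero_one hx i hb)) hα hβ hαβ
  have hglog : CubeLogConcave g := by
    apply CubeLogConcave.congr (f := fun x => f (φ x)) _ hgI
    intro x hx y hy s hs0 hs1
    simp only
    rw [hφaff _ _ _ _ (by ring)]
    exact hl _ (hφO x hx) _ (hφO y hy) s hs0 hs1
  have trans : ∀ ψ : (Fin n → ℝ) → ℝ, ∫ x in Icc (0 : Fin n → ℝ) 1, g x * ψ (φ x) =
      (ρ ^ n)⁻¹ * ∫ x in J, f x * ψ x := by
    intro ψ
    rw [hJ, ← setIntegral_Icc_comp_affine (fun x => f x * ψ x) hρ]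
    apply setIntegral_congr_fun measurableSet_Icc
    intro x hx
    simp only [← hgI x hx, hφ]
  have hρn : 0 < (ρ ^ n)⁻¹ := by positivity
  have t1 := trans (fun x => Real.exp (-(4 / 9 * t * d x)))
  have t2 := trans (fun x => d x ^ 2)
  have t3 := trans (fun _ => 1)
  simp only [mul_one] at t3
  have main := integral_exp_neg_dist_le_of_continuous (d := fun x => d (φ x)) (t := t) hgc hgconv
    hglog hgO hL (by rw [t3]; exact mul_pos hρn hpos) (hd.comp hφc) (fun x => hd0 _)
    (fun x => hdt _) ?_
  · rw [t1, t2, t3] at main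
    rw [mul_assoc, mul_le_mul_iff_right₀ hρn] at main
    refine main.trans (le_of_eq ?_)
    congr 3
    have := hpos.ne'
    field_simp
  · intro x y
    refine (hdl (φ x) (φ y)).trans ?_
    refine add_le_add le_rfl (Real.sqrt_le_sqrt (Finset.sum_le_sum fun i _ => ?_))
    have e : φ x i - φ y i = ρ * (x i - y i) := by simp [hφ]; ring
    rw [e, mul_pow]
    exact mul_le_of_le_one_left (sq_nonneg _) (by nlinarith)

/-- The estimate for an integrable density on the open unit cube. -/
theorem integral_exp_neg_dist_le_openCube {n : ℕ} {f d : (Fin n → ℝ) → ℝ} {t : ℝ}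
    (hconv : ConvexOn ℝ (univ.pi fun _ => Ioo (0 : ℝ) 1) f)
    (h0 : ∀ x ∈ univ.pi fun _ : Fin n => Ioo (0 : ℝ) 1, 0 ≤ f x)
    (hl : ∀ x ∈ univ.pi fun _ : Fin n => Ioo (0 : ℝ) 1,
      ∀ y ∈ univ.pi fun _ : Fin n => Ioo (0 : ℝ) 1, ∀ s : ℝ, 0 < s → s < 1 →
        f x ^ (1 - s) * f y ^ s ≤ f ((1 - s) • x + s • y))
    (hint : IntegrableOn f (univ.pi fun _ => Ioo (0 : ℝ) 1))
    (hpos : 0 < ∫ x in univ.pi fun _ : Fin n => Ioo (0 : ℝ) 1, f x)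
    (hd : Continuous d) (hd0 : ∀ x, 0 ≤ d x) (hdt : ∀ x, d x ≤ t)
    (hdl : ∀ x y, d x ≤ d y + √(∑ i, (x i - y i) ^ 2)) :
    ∫ x in univ.pi fun _ : Fin n => Ioo (0 : ℝ) 1, f x * Real.exp (-(4 / 9 * t * d x)) ≤
      (∫ x in univ.pi fun _ : Fin n => Ioo (0 : ℝ) 1, f x) * Real.exp (-(2 / 9 *
        (∫ x in univ.pi fun _ : Fin n => Ioo (0 : ℝ) 1, f x * d x ^ 2) /
          ∫ x in univ.pi fun _ : Fin n => Ioo (0 : ℝ) 1, f x)) := by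
  set O : Set (Fin n → ℝ) := univ.pi fun _ => Ioo (0 : ℝ) 1 with hO
  set δ : ℕ → ℝ := fun k => 1 / ((k : ℝ) + 3) with hδ
  have hδ0 : ∀ k, 0 < δ k := fun k => by simp only [hδ]; positivity
  have hδ1 : ∀ k, δ k ≤ 1 / 3 := fun k => by
    simp only [hδ]
    gcongr
    linarith [k.cast_nonneg (α := ℝ)]
  have hδanti : Antitone δ := fun j k hjk => by
    simp only [hδ]
    have : (j : ℝ) ≤ k := by exact_mod_cast hjk
    gcongr
  have hδlim : Filter.Tendsto δ Filter.atTop (nhds 0) := by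
    have := (tendsto_const_div_atTop_nhds_zero_nat (1 : ℝ)).comp (Filter.tendsto_add_atTop_nat 3)
    refine this.congr fun k => ?_
    simp [hδ]
  set J : ℕ → Set (Fin n → ℝ) := fun k =>
    Icc (fun _ => δ k) (fun _ => δ k + (1 - 2 * δ k)) with hJ
  have hJm : Monotone J := by
    intro j k hjk
    have := hδanti hjk
    exact Icc_subset_Icc (fun _ => this) (fun _ => by linarith)
  have hJO : ⋃ k, J k = O := by
    ext x
    simp only [mem_iUnion, hJ, hO, mem_Icc, Pi.le_def, mem_pi, mem_univ, true_imp_iff, mem_Ioo]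
    constructor
    · rintro ⟨k, h1, h2⟩ i
      have := h1 i
      have := h2 i
      have := hδ0 k
      constructor <;> linarith
    · intro h
      have h1 : ∀ᶠ k in Filter.atTop, ∀ i, δ k < min (x i) (1 - x i) := by
        rw [Filter.eventually_all]
        exact fun i => hδlim.eventually (gt_mem_nhds (lt_min (h i).1 (by linarith [(h i).2])))
      obtain ⟨k, hk⟩ := h1.exists
      refine ⟨k, fun i => ?_, fun i => ?_⟩
      · exact ((hk i).trans_le (min_le_left _ _)).le
      · linarith [(hk i).trans_le (min_le_right _ _)]
  have lim : ∀ ψ : (Fin n → ℝ) → ℝ, IntegrableOn ψ O → Filter.Tendsto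
      (fun k => ∫ x in J k, ψ x) Filter.atTop (nhds (∫ x in O, ψ x)) := by
    intro ψ hψ
    rw [← hJO] at hψ ⊢
    exact tendsto_setIntegral_of_monotone (fun k => measurableSet_Icc) hJm hψ
  have ht : 0 ≤ t := (hd0 0).trans (hdt 0)
  have i1 : IntegrableOn (fun x => f x * Real.exp (-(4 / 9 * t * d x))) O := by
    apply Integrable.mul_bdd (c := 1) hint
    · exact Continuous.aestronglyMeasurable (by fun_prop)
    · filter_upwards with x
      rw [Real.norm_eq_abs, abs_of_pos (Real.exp_pos _)]
      exact Real.exp_le_one_iff.2 (by have := mul_nonneg ht (hd0 x); linarith)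
  have i2 : IntegrableOn (fun x => f x * d x ^ 2) O := by
    apply Integrable.mul_bdd (c := t ^ 2) hint
    · exact Continuous.aestronglyMeasurable (by fun_prop)
    · filter_upwards with x
      have := hd0 x
      have := hdt x
      rw [Real.norm_eq_abs, abs_of_nonneg (by positivity)]
      gcongr
  have l1 := lim _ i1
  have l2 := lim _ i2
  have l3 := lim _ hint
  refine le_of_tendsto_of_tendsto l1 (l3.mul ((Real.continuous_exp.tendsto _).comp
    (((l2.const_mul (2 / 9)).div l3 hpos.ne').neg))) ?_
  filter_upwards [l3.eventually (lt_mem_nhds hpos)] with k hk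
  exact integral_exp_neg_dist_le_subcube (hδ0 k) (by linarith [hδ1 k]) (by linarith [hδ0 k])
    hconv h0 hl hk hd hd0 hdt hdl

/-! ### Unit cubes in Euclidean space -/

lemma AffineIsometryEquiv.measurePreserving_euclidean {n : ℕ}
    (e : EuclideanSpace ℝ (Fin n) ≃ᵃⁱ[ℝ] EuclideanSpace ℝ (Fin n)) :
    MeasurePreserving e volume volume := by
  have h : (e : EuclideanSpace ℝ (Fin n) → EuclideanSpace ℝ (Fin n)) =
      (fun y => y + e 0) ∘ e.linearIsometryEquiv := by
    ext1 x
    simpa using e.map_vadd 0 x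
  rw [h]
  exact (measurePreserving_add_right volume (e 0)).comp e.linearIsometryEquiv.measurePreserving

lemma LogConcaveOn.rpow_mul_rpow_le {n : ℕ} {Q : Set (EuclideanSpace ℝ (Fin n))}
    {f : EuclideanSpace ℝ (Fin n) → ℝ} (h : LogConcaveOn Q f) (hQ : Convex ℝ Q)
    {x y : EuclideanSpace ℝ (Fin n)} (hx : x ∈ Q) (hy : y ∈ Q) {s : ℝ} (h0 : 0 < s) (h1 : s < 1) :
    f x ^ (1 - s) * f y ^ s ≤ f ((1 - s) • x + s • y) := by
  have hz : 0 ≤ f ((1 - s) • x + s • y) :=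
    h.1 _ (hQ hx hy (by linarith) h0.le (by ring))
  rcases (h.1 x hx).eq_or_lt with hfx | hfx
  · rwa [← hfx, Real.zero_rpow (by linarith), zero_mul]
  rcases (h.1 y hy).eq_or_lt with hfy | hfy
  · rwa [← hfy, Real.zero_rpow (by linarith), mul_zero]
  have hmem := h.2.1 ⟨hx, hfx⟩ ⟨hy, hfy⟩ (by linarith : 0 ≤ 1 - s) h0.le (by ring)
  have := h.2.2 ⟨hx, hfx⟩ ⟨hy, hfy⟩ (by linarith : 0 ≤ 1 - s) h0.le (by ring)
  simp only [smul_eq_mul] at this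
  rw [Real.rpow_def_of_pos hfx, Real.rpow_def_of_pos hfy, ← Real.exp_add]
  refine (Real.le_log_iff_exp_le hmem.2).1 ?_
  linarith

/-- The parametrization of `ℝⁿ` by coordinate tuples that places the coordinate cube in the position
prescribed by `e`. -/
noncomputable def cubeChart {n : ℕ}
    (e : EuclideanSpace ℝ (Fin n) ≃ᵃⁱ[ℝ] EuclideanSpace ℝ (Fin n)) (x : Fin n → ℝ) :
    EuclideanSpace ℝ (Fin n) :=
  e (WithLp.toLp 2 x)

section cubeChart

variable {n : ℕ} (e : EuclideanSpace ℝ (Fin n) ≃ᵃⁱ[ℝ] EuclideanSpace ℝ (Fin n))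

lemma measurePreserving_cubeChart : MeasurePreserving (cubeChart e) volume volume :=
  e.measurePreserving_euclidean.comp (PiLp.volume_preserving_toLp (Fin n))

lemma measurableEmbedding_cubeChart : MeasurableEmbedding (cubeChart e) :=
  e.toHomeomorph.measurableEmbedding.comp
    (MeasurableEquiv.toLp 2 (Fin n → ℝ)).measurableEmbedding

lemma continuous_cubeChart : Continuous (cubeChart e) :=
  e.continuous.comp (PiLp.continuous_toLp 2 _)

lemma dist_cubeChart (x y : Fin n → ℝ) :
    dist (cubeChart e x) (cubeChart e y) = √(∑ i, (x i - y i) ^ 2) := by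
  simp only [cubeChart, e.dist_map, EuclideanSpace.dist_eq, Real.dist_eq, sq_abs]

lemma cubeChart_combo (x y : Fin n → ℝ) {a b : ℝ} (hab : a + b = 1) :
    cubeChart e (a • x + b • y) = a • cubeChart e x + b • cubeChart e y := by
  have := Convex.combo_affine_apply (x := WithLp.toLp 2 x) (y := WithLp.toLp 2 y)
    (f := (e.toAffineEquiv : EuclideanSpace ℝ (Fin n) →ᵃ[ℝ] EuclideanSpace ℝ (Fin n))) hab
  exact this

lemma cubeChart_image_Ioo :
    cubeChart e '' (univ.pi fun _ => Ioo (0 : ℝ) 1) = e '' openCube n := by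
  have : openCube n = WithLp.toLp 2 '' (univ.pi fun _ : Fin n => Ioo (0 : ℝ) 1) := by
    ext x
    constructor
    · intro hx
      exact ⟨WithLp.ofLp x, fun i _ => hx i, rfl⟩
    · rintro ⟨y, hy, rfl⟩ i
      exact hy i (mem_univ i)
  rw [this, image_image]
  rfl

lemma cubeChart_image_Icc :
    cubeChart e '' Icc 0 1 = e '' closedCube n := by
  have : closedCube n = WithLp.toLp 2 '' Icc (0 : Fin n → ℝ) 1 := by
    ext x
    constructor
    · intro hx
      exact ⟨WithLp.ofLp x, ⟨fun i => (hx i).1, fun i => (hx i).2⟩, rfl⟩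
    · rintro ⟨y, hy, rfl⟩ i
      exact ⟨hy.1 i, hy.2 i⟩
  rw [this, image_image]
  rfl

end cubeChart

/-- Open and closed unit cubes differ by a null set, so both reduce to a chart of the open one. -/
lemma IsUnitCube.exists_chart {n : ℕ} {Q : Set (EuclideanSpace ℝ (Fin n))} (hQ : IsUnitCube Q) :
    ∃ e : EuclideanSpace ℝ (Fin n) ≃ᵃⁱ[ℝ] EuclideanSpace ℝ (Fin n),
      cubeChart e '' (univ.pi fun _ => Ioo (0 : ℝ) 1) ⊆ Q ∧
      (cubeChart e '' (univ.pi fun _ => Ioo (0 : ℝ) 1) : Set _) =ᵐ[volume] Q := by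
  obtain ⟨e, rfl | rfl⟩ := hQ
  · rw [← cubeChart_image_Ioo]
    exact ⟨e, Subset.rfl, Filter.EventuallyEq.rfl⟩
  · rw [← cubeChart_image_Icc]
    have hsub : (univ.pi fun _ => Ioo (0 : ℝ) 1) ⊆ Icc (0 : Fin n → ℝ) 1 := fun x hx =>
      ⟨fun i => (hx i (mem_univ i)).1.le, fun i => (hx i (mem_univ i)).2.le⟩
    have hae : (univ.pi fun _ => Ioo (0 : ℝ) 1 : Set (Fin n → ℝ)) =ᵐ[volume] Icc 0 1 :=
      Measure.univ_pi_Ioo_ae_eq_Icc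
    refine ⟨e, image_mono hsub, ?_⟩
    refine (image_mono hsub).eventuallyLE.antisymm ?_
    rw [ae_le_set, ← image_sdiff (measurableEmbedding_cubeChart e).injective]
    rw [← (measurePreserving_cubeChart e).measure_preimage_emb (measurableEmbedding_cubeChart e),
      preimage_image_eq _ (measurableEmbedding_cubeChart e).injective]
    exact ae_le_set.1 hae.symm.le

theorem mainTheorem8 (n : ℕ) (Q : Set (EuclideanSpace ℝ (Fin n))) (hQ : IsUnitCube Q)
    (μ : MeasureTheory.Measure (EuclideanSpace ℝ (Fin n)))
    (hμ : MeasureTheory.IsProbabilityMeasure μ)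
    (f : EuclideanSpace ℝ (Fin n) → ℝ) (hdens : HasDensityOn μ Q f)
    (hlog : LogConcaveOn Q f) (hconv : ConvexOn ℝ Q f)
    (A : Set (EuclideanSpace ℝ (Fin n))) (hA : MeasurableSet A)
    (t : ℝ) (ht : 0 < t) (hhalf : 1 / 2 ≤ μ.real A) :
    1 - Real.exp (-t ^ 2 / 9) ≤
      μ.real (A + t • Metric.closedBall (0 : EuclideanSpace ℝ (Fin n)) 1) := by
  -- it suffices to bound the measure of the closed set of points at distance at least `t` from `A`
  set B : Set (EuclideanSpace ℝ (Fin n)) := (Metric.thickening t A)ᶜ with hB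
  have hBc : IsClosed B := Metric.isOpen_thickening.isClosed_compl
  have hsub : Metric.thickening t A ⊆ A + t • Metric.closedBall 0 1 := by
    intro x hx
    obtain ⟨a, ha, hxa⟩ := Metric.mem_thickening_iff.1 hx
    refine ⟨a, ha, x - a, ?_, by simp⟩
    rw [smul_unitClosedBall_of_nonneg ht.le, mem_closedBall_zero_iff, ← dist_eq_norm]
    exact hxa.le
  suffices hmain : μ.real B ≤ Real.exp (-t ^ 2 / 9) by
    have h1 : μ.real (Metric.thickening t A) ≤ μ.real (A + t • Metric.closedBall 0 1) :=
      measureReal_mono hsub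
    have h2 := probReal_compl_eq_one_sub (μ := μ)
      (Metric.isOpen_thickening (δ := t) (E := A)).measurableSet
    linarith
  rcases B.eq_empty_or_nonempty with hBe | hBne
  · rw [hBe, measureReal_empty]
    exact (Real.exp_pos _).le
  obtain ⟨e, hOQ, hae⟩ := hQ.exists_chart
  set φ := cubeChart e with hφ
  set O : Set (Fin n → ℝ) := univ.pi fun _ => Ioo (0 : ℝ) 1 with hO
  set g : (Fin n → ℝ) → ℝ := fun x => f (φ x) with hg
  have hOo : IsOpen O := isOpen_set_pi finite_univ fun _ _ => isOpen_Ioo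
  have hOQ' : ∀ x ∈ O, φ x ∈ Q := fun x hx => hOQ (mem_image_of_mem _ hx)
  have hOconv : Convex ℝ O := convex_pi fun _ _ => convex_Ioo 0 1
  have hgconv : ConvexOn ℝ O g := by
    refine ⟨hOconv, fun x hx y hy a b ha hb hab => ?_⟩
    simp only [hg, hφ]
    rw [cubeChart_combo e x y hab]
    exact hconv.2 (hOQ' x hx) (hOQ' y hy) ha hb hab
  have hg0 : ∀ x ∈ O, 0 ≤ g x := fun x hx => hlog.1 _ (hOQ' x hx)
  have hglog : ∀ x ∈ O, ∀ y ∈ O, ∀ s : ℝ, 0 < s → s < 1 →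
      g x ^ (1 - s) * g y ^ s ≤ g ((1 - s) • x + s • y) := by
    intro x hx y hy s hs0 hs1
    simp only [hg, hφ]
    rw [cubeChart_combo e x y (by ring)]
    exact hlog.rpow_mul_rpow_le hconv.1 (hOQ' x hx) (hOQ' y hy) hs0 hs1
  have hgm : AEStronglyMeasurable g (volume.restrict O) :=
    (hgconv.continuousOn hOo).aestronglyMeasurable hOo.measurableSet
  have hg0' : 0 ≤ᵐ[volume.restrict O] g := by
    filter_upwards [ae_restrict_mem hOo.measurableSet] with x hx using hg0 x hx
  have hφc : Continuous φ := continuous_cubeChart e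
  have hμS : ∀ S, MeasurableSet S →
      μ S = ∫⁻ x in φ ⁻¹' S ∩ O, ENNReal.ofReal (g x) := by
    intro S hS
    have hinj : φ ⁻¹' (φ '' O) = O := preimage_image_eq _ (measurableEmbedding_cubeChart e).injective
    have hμ' : μ = (volume.restrict Q).withDensity fun x => ENNReal.ofReal (f x) := hdens
    rw [hμ', withDensity_apply _ hS, Measure.restrict_congr_set hae.symm,
      Measure.restrict_restrict hS,
      ← (measurePreserving_cubeChart e).setLIntegral_comp_preimage_emb
        (measurableEmbedding_cubeChart e), preimage_inter]
    rw [← hφ, hinj]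
  have hgint : IntegrableOn g O := by
    rw [IntegrableOn, ← lintegral_ofReal_ne_top_iff_integrable hgm hg0']
    have := hμS univ MeasurableSet.univ
    rw [preimage_univ, univ_inter, measure_univ] at this
    rw [← this]
    exact ENNReal.one_ne_top
  have hμr : ∀ S, MeasurableSet S → μ.real S = ∫ x in φ ⁻¹' S ∩ O, g x := by
    intro S hS
    have hsubO : volume.restrict (φ ⁻¹' S ∩ O) ≤ volume.restrict O :=
      Measure.restrict_mono inter_subset_right le_rfl
    rw [measureReal_def, hμS S hS, integral_eq_lintegral_of_nonneg_ae
      (ae_mono hsubO hg0') (hgm.mono_measure hsubO)]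
  have hone : ∫ x in O, g x = 1 := by
    have := hμr univ MeasurableSet.univ
    rw [preimage_univ, univ_inter, probReal_univ] at this
    exact this.symm
  -- the truncated distance to `B`
  set d : (Fin n → ℝ) → ℝ := fun x => min (Metric.infDist (φ x) B) t with hd
  have hdc : Continuous d := ((Metric.continuous_infDist_pt B).comp hφc).min continuous_const
  have hd0 : ∀ x, 0 ≤ d x := fun x => le_min Metric.infDist_nonneg ht.le
  have hdt : ∀ x, d x ≤ t := fun x => min_le_right _ _
  have hdl : ∀ x y, d x ≤ d y + √(∑ i, (x i - y i) ^ 2) := by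
    intro x y
    rw [← dist_cubeChart e, ← hφ]
    have h1 := Metric.infDist_le_infDist_add_dist (s := B) (x := φ x) (y := φ y)
    simp only [hd]
    rcases le_total (Metric.infDist (φ y) B) t with h | h
    · rw [min_eq_left h]
      exact (min_le_left _ _).trans h1
    · rw [min_eq_right h]
      exact (min_le_right _ _).trans (le_add_of_nonneg_right dist_nonneg)
  have hdB : ∀ x ∈ φ ⁻¹' B, d x = 0 := by
    intro x hx
    simp only [hd, Metric.infDist_zero_of_mem (show φ x ∈ B from hx)]
    exact min_eq_left ht.le
  have hdA : ∀ x ∈ φ ⁻¹' A, d x = t := by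
    intro x hx
    apply min_eq_right
    rw [Metric.le_infDist hBne]
    intro y hy
    by_contra! hlt
    exact hy (Metric.mem_thickening_iff.2 ⟨φ x, hx, by rwa [dist_comm]⟩)
  have main := integral_exp_neg_dist_le_openCube hgconv hg0 hglog hgint (by rw [← hO, hone]; simp)
    hdc hd0 hdt hdl
  rw [← hO, hone, one_mul, div_one] at main
  have i1 : IntegrableOn (fun x => g x * Real.exp (-(4 / 9 * t * d x))) O := by
    apply Integrable.mul_bdd (c := 1) hgint
    · exact Continuous.aestronglyMeasurable (by fun_prop)
    · filter_upwards with x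
      rw [Real.norm_eq_abs, abs_of_pos (Real.exp_pos _)]
      exact Real.exp_le_one_iff.2 (by have := mul_nonneg ht.le (hd0 x); linarith)
  have i2 : IntegrableOn (fun x => g x * d x ^ 2) O := by
    apply Integrable.mul_bdd (c := t ^ 2) hgint
    · exact Continuous.aestronglyMeasurable (by fun_prop)
    · filter_upwards with x
      have := hd0 x
      have := hdt x
      rw [Real.norm_eq_abs, abs_of_nonneg (by positivity)]
      gcongr
  have hBm : MeasurableSet (φ ⁻¹' B ∩ O) :=
    (hφc.measurable hBc.measurableSet).inter hOo.measurableSet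
  have hAm : MeasurableSet (φ ⁻¹' A ∩ O) := (hφc.measurable hA).inter hOo.measurableSet
  have upper : μ.real B ≤ ∫ x in O, g x * Real.exp (-(4 / 9 * t * d x)) := by
    rw [hμr B hBc.measurableSet]
    calc ∫ x in φ ⁻¹' B ∩ O, g x
        = ∫ x in φ ⁻¹' B ∩ O, g x * Real.exp (-(4 / 9 * t * d x)) := by
          apply setIntegral_congr_fun hBm
          intro x hx
          simp [hdB x hx.1]
      _ ≤ _ := by
          apply setIntegral_mono_set i1 _ inter_subset_right.eventuallyLE
          filter_upwards [hg0'] with x hx using mul_nonneg hx (Real.exp_pos _).le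
  have lower : t ^ 2 * μ.real A ≤ ∫ x in O, g x * d x ^ 2 := by
    rw [hμr A hA]
    calc t ^ 2 * ∫ x in φ ⁻¹' A ∩ O, g x = ∫ x in φ ⁻¹' A ∩ O, g x * d x ^ 2 := by
          rw [← integral_const_mul]
          apply setIntegral_congr_fun hAm
          intro x hx
          simp only [hdA x hx.1]
          ring
      _ ≤ _ := by
          apply setIntegral_mono_set i2 _ inter_subset_right.eventuallyLE
          filter_upwards [hg0'] with x hx using mul_nonneg hx (sq_nonneg _)
  refine upper.trans (main.trans (Real.exp_le_exp.2 ?_))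
  have := mul_le_mul_of_nonneg_left hhalf (sq_nonneg t)
  linarith
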